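/- Let $m\ge 1$. There is a constant $\kappa=\kappa(m)>0$, depending only on $m$, with the following property. Notation. Write $\mathbb H$ for the quaternions with units $e_1,e_2,e_3$, $e_1^2=e_2^2=e_3^2=e_1e_2e_3=-1$, and $\mathbb C\otimes\mathbb H=\{q_1+iq_2: q_1,q_2\in\mathbb H\}$, where $i$ commutes with $\mathbb H$, with $\langle q_1+iq_2,w_1+iw_2\rangle=\overline{q_1}w_1+\overline{q_2}w_2\in\mathbb H$ and $|u|^2=\langle u,u\rangle$. Let $\Omega\subset\mathbb R^3$ be a bounded domain with boundary of class $C^1$, let $\langle u,v\rangle_{L^2}=\int_\Omega\langle u,v\rangle\,dx$, and let $H^m_0=H^m_0(\Omega,\mathbb C\otimes\mathbb H)$ be the closure of $C_0^\infty(\Omega,\mathbb C\otimes\mathbb H)$ in the Sobolev space $H^m(\Omega,\mathbb C\otimes\mathbb H)$. Let $C_\Omega$ be the Poincaré constant of $\Omega$, i.e. the least $C\ge 0$ with $\|\varphi\|_{L^2}\le C\|\nabla\varphi\|_{L^2}$ for all $\varphi\in C_0^\infty(\Omega,\mathbb R)$, and put $K(m,\Omega)=\kappa(m)\max(C_\Omega,C_\Omega^m)$.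 Let $a_1,a_2,a_3\in C^m(\overline\Omega,\mathbb R)$ and $$T=i^{m-1}\left(a_1e_1\partial_{x_1}^m+a_2e_2\partial_{x_2}^m+a_3e_3\partial_{x_3}^m\right),$$ $$C_T=\min_{l=1,2,3}\inf_{x\in\Omega}a_l(x)^2,\qquad M=K(m,\Omega)^2\Bigl(\sup_{\substack{t=1,\dots,m\\ j,l=1,2,3\\ x\in\Omega}}|\partial_{x_j}^t a_l(x)|\Bigr)^2 .$$ For $s\in\mathbb H$ let $b_s$ be the form on $H^m_0\times H^m_0$ that is obtained from $\langle (T^2-2\operatorname{Re}(s)T+|s|^2)u,v\rangle_{L^2}$ by integration by parts, namely $$\begin{aligned} b_s(u,v)={}&\sum_{l=1}^3\int_\Omega\langle a_l^2\partial_{x_l}^mu,\partial_{x_l}^mv\rangle\,dx+|s|^2\int_\Omega\langle u,v\rangle\,dx+\sum_{l=1}^3\sum_{\substack{t_1+t_2=m\\ t_2\le m-1}}\binom m{t_1}\int_\Omega\langle\partial_{x_l}^{t_1}(a_l^2)\,\partial_{x_l}^mu,\partial_{x_l}^{t_2}v\rangle\,dx\\ &+\sum_{l=1}^3 B_{ll}(1;u,v)-\sum_{l<j}\bigl(B_{lj}(e_le_j;u,v)-B_{jl}(e_le_j;u,v)\bigr)-2\operatorname{Re}(s)\,\langle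 Tu,v\rangle_{L^2},\end{aligned}$$ $$B_{lj}(q;u,v)=\sum_{k=1}^m(-1)^k\sum_{t_1+t_2+t_3=m-k}\binom mk\frac{(m-k)!}{t_1!\,t_2!\,t_3!}\int_\Omega\langle q\,\partial_{x_l}^{t_1}(a_l)\,\partial_{x_l}^{t_2+k}(a_j)\,\partial_{x_j}^mu,\partial_{x_l}^{t_3}v\rangle\,dx .$$ Theorem. Suppose that $C_T>0$ and $\frac{C_T}2-M>0$. Then for every $s\in\mathbb H\setminus\{0\}$ with $\operatorname{Re}(s)=0$: (I) For every $F\in L^2(\Omega,\mathbb C\otimes\mathbb H)$ there is a unique $u\in H^m_0$ such that $b_s(u,v)=\langle F,v\rangle_{L^2}$ for all $v\in H^m_0$. Moreover every $u\in H^m_0$, in particular this weak solution, satisfies $$\|u\|_{L^2}^2\le\frac1{|s|^2}\operatorname{Re}\,b_s(u,u).$$ (II) For every $u\in H^m_0$, $$C_1\,\|Tu\|_{L^2}^2\le\operatorname{Re}\,b_s(u,u),\qquad C_1:=\frac{C_T-2M}{2C_T}>0 .$$ -/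

import Mathlib

open MeasureTheory Filter Topology
open scoped Quaternion ContDiff

noncomputable section

namespace QuatOp

/-- Euclidean three-space. -/
abbrev E3 : Type := EuclideanSpace ℝ (Fin 3)

/-! ### Domains -/

/-- The boundary of `Ω` is of class `C¹`: near each boundary point, after a rigid change of
the coordinate axes, `Ω` is the region strictly above the graph of a `C¹` function. -/
def HasC1Boundary (Ω : Set E3) : Prop :=
  ∀ p ∈ frontier Ω, ∃ r > 0, ∃ (L : E3 ≃ₗᵢ[ℝ] E3) (γ : EuclideanSpace ℝ (Fin 2) → ℝ),
    ContDiff ℝ 1 γ ∧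
      ∀ x ∈ Metric.ball p r, x ∈ Ω ↔ γ (WithLp.toLp 2 ![L x 0, L x 1]) < L x 2

/-- A bounded domain (nonempty connected open set) with boundary of class `C¹`. -/
structure IsBoundedC1Domain (Ω : Set E3) : Prop where
  isOpen : IsOpen Ω
  isConnected : IsConnected Ω
  isBounded : Bornology.IsBounded Ω
  c1Boundary : HasC1Boundary Ω

/-! ### Classical derivatives -/

section Classical

variable {F : Type*} [NormedAddCommGroup F] [NormedSpace ℝ F]

/-- The classical partial derivative `∂_{x_l}`. -/
def pd (l : Fin 3) (f : E3 → F) : E3 → F :=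
  fun x => fderiv ℝ f x (EuclideanSpace.single l (1 : ℝ))

/-- The classical derivative `∂^β = ∂_{x_1}^{β_1} ∂_{x_2}^{β_2} ∂_{x_3}^{β_3}`. -/
def mpd (β : Fin 3 → ℕ) (f : E3 → F) : E3 → F :=
  (pd 0)^[β 0] ((pd 1)^[β 1] ((pd 2)^[β 2] f))

/-- `φ ∈ C_0^∞(Ω, F)`. -/
def IsTest (Ω : Set E3) (φ : E3 → F) : Prop :=
  ContDiff ℝ ∞ φ ∧ HasCompactSupport φ ∧ tsupport φ ⊆ Ω

end Classical

/-- `a ∈ C^m(closure Ω, ℝ)`: `a` is `C^m` in `Ω` and its derivatives of order at most `m`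
extend continuously to the closure of `Ω`. -/
def IsCmClosure (m : ℕ) (Ω : Set E3) (a : E3 → ℝ) : Prop :=
  ContDiffOn ℝ m a Ω ∧
    ∀ β : Fin 3 → ℕ, ∑ i, β i ≤ m →
      ∃ g : E3 → ℝ, ContinuousOn g (closure Ω) ∧ Set.EqOn (mpd β a) g Ω

/-- The Poincaré constant of `Ω`: the least `C ≥ 0` such that `‖φ‖ ≤ C ‖∇φ‖` in `L²(Ω)` for
all test functions `φ`. -/
def poincareConst (Ω : Set E3) : ℝ :=
  sInf {C : ℝ | 0 ≤ C ∧ ∀ φ : E3 → ℝ, IsTest Ω φ →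
    ∫ x in Ω, φ x ^ 2 ≤ C ^ 2 * ∫ x in Ω, ∑ l, pd l φ x ^ 2}

/-! ### The right quaternionic Hilbert space `ℂ ⊗ ℍ` -/

/-- `ℂ ⊗ ℍ`; the pair `(q₁, q₂)` stands for `q₁ + i q₂`, with `|q₁ + i q₂|² = |q₁|² + |q₂|²`. -/
abbrev CH : Type := WithLp 2 (ℍ[ℝ] × ℍ[ℝ])

/-- The quaternion-valued scalar product of `ℂ ⊗ ℍ`. -/
def chInner (u v : CH) : ℍ[ℝ] := star u.fst * v.fst + star u.snd * v.snd

/-- Multiplication by the imaginary unit `i` of `ℂ`. -/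
def mulI (u : CH) : CH := WithLp.toLp 2 (-u.snd, u.fst)

/-- Left multiplication by a quaternion. -/
def mulL (q : ℍ[ℝ]) (u : CH) : CH := WithLp.toLp 2 (q * u.fst, q * u.snd)

/-- The imaginary units `e₁, e₂, e₃` of `ℍ`. -/
def e : Fin 3 → ℍ[ℝ] := ![⟨0, 1, 0, 0⟩, ⟨0, 0, 1, 0⟩, ⟨0, 0, 0, 1⟩]

/-! ### Sobolev spaces -/

/-- `L²(Ω, ℂ ⊗ ℍ)`. -/
abbrev L2 (Ω : Set E3) : Type := Lp CH 2 (volume.restrict Ω)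

/-- The scalar product of `L²(Ω, ℂ ⊗ ℍ)`. -/
def l2Inner (Ω : Set E3) (u v : E3 → CH) : ℍ[ℝ] := ∫ x in Ω, chInner (u x) (v x)

/-- `w ∈ L²` is the weak derivative `∂^β u` in `Ω`. -/
def IsWeakDeriv (Ω : Set E3) (β : Fin 3 → ℕ) (u w : L2 Ω) : Prop :=
  ∀ φ : E3 → ℝ, IsTest Ω φ →
    ∫ x in Ω, mpd β φ x • u x = (-1 : ℝ) ^ (∑ i, β i) • ∫ x in Ω, φ x • w x

open Classical in
/-- The weak derivative `∂^β u` (zero if there is none in `L²`). -/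
def weakDeriv (Ω : Set E3) (β : Fin 3 → ℕ) (u : L2 Ω) : L2 Ω :=
  if h : ∃ w, IsWeakDeriv Ω β u w then h.choose else 0

/-- The weak derivative `∂_{x_l}^t u`. -/
def wpd (Ω : Set E3) (l : Fin 3) (t : ℕ) (u : L2 Ω) : L2 Ω := weakDeriv Ω (Pi.single l t) u

/-- `u ∈ H^m(Ω, ℂ ⊗ ℍ)`. -/
def MemH (m : ℕ) (Ω : Set E3) (u : L2 Ω) : Prop :=
  ∀ β : Fin 3 → ℕ, ∑ i, β i ≤ m → ∃ w, IsWeakDeriv Ω β u w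

/-- `u ∈ H^m_0(Ω, ℂ ⊗ ℍ)`: `u` is in `H^m` and is the limit, in the norm of `H^m`, of a
sequence in `C_0^∞(Ω, ℂ ⊗ ℍ)`. -/
def MemH0 (m : ℕ) (Ω : Set E3) (u : L2 Ω) : Prop :=
  MemH m Ω u ∧ ∃ φ : ℕ → E3 → CH, (∀ n, IsTest Ω (φ n)) ∧
    ∀ β : Fin 3 → ℕ, ∑ i, β i ≤ m →
      Tendsto (fun n => eLpNorm (fun x => mpd β (φ n) x - weakDeriv Ω β u x) 2
        (volume.restrict Ω)) atTop (𝓝 0)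

/-! ### The operator and the bilinear form -/

/-- `T u = i^(m-1) (a₁ e₁ ∂_{x_1}^m u + a₂ e₂ ∂_{x_2}^m u + a₃ e₃ ∂_{x_3}^m u)`. -/
def opT (m : ℕ) (Ω : Set E3) (a : Fin 3 → E3 → ℝ) (u : L2 Ω) : E3 → CH :=
  fun x => mulI^[m - 1] (∑ l, a l x • mulL (e l) (wpd Ω l m u x))

/-- `∑_{k=1}^m (-1)^k ∑_{|t|=m-k} (m choose k) (m-k choose t)
  ∫_Ω ⟨q ∂_{x_l}^{t₁}(f) ∂_{x_l}^{t₂+k}(g) ∂_{x_j}^m u, ∂_{x_l}^{t₃} v⟩ dx`. -/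
def lowerTerms (m : ℕ) (Ω : Set E3) (q : ℍ[ℝ]) (l j : Fin 3) (f g : E3 → ℝ) (u v : L2 Ω) :
    ℍ[ℝ] :=
  ∑ k ∈ Finset.Icc 1 m, ∑ t ∈ Finset.Nat.antidiagonalTuple 3 (m - k),
    ((-1 : ℝ) ^ k * (m.choose k : ℝ) * (Nat.multinomial Finset.univ t : ℝ)) •
      ∫ x in Ω, chInner
        (((pd l)^[t 0] f x * (pd l)^[t 1 + k] g x) • mulL q (wpd Ω j m u x))
        (wpd Ω l (t 2) v x)

/-- The form `b_s(u, v)` obtained from `⟨Q_s(T) u, v⟩_{L²}`, with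
`Q_s(T) = T² - 2 Re(s) T + |s|²`, by integration by parts. As `e_l² = -1` and
`e_j e_l = - e_l e_j`, we have `(-1)^m T² = ∑_l (a_l ∂_l^m)² - ∑_{l<j} e_l e_j [a_l ∂_l^m, a_j ∂_j^m]`,
whence the minus sign in front of the sum over `l < j`. -/
def bForm (m : ℕ) (Ω : Set E3) (a : Fin 3 → E3 → ℝ) (s : ℍ[ℝ]) (u v : L2 Ω) : ℍ[ℝ] :=
  ∑ l, (∫ x in Ω, chInner (a l x ^ 2 • wpd Ω l m u x) (wpd Ω l m v x))
  + ‖s‖ ^ 2 • l2Inner Ω u v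
  + ∑ l, ∑ t ∈ (Finset.HasAntidiagonal.antidiagonal m).filter (fun t => t.2 ≤ m - 1),
      (m.choose t.1 : ℝ) •
        (∫ x in Ω, chInner ((pd l)^[t.1] (fun y => a l y ^ 2) x • wpd Ω l m u x)
          (wpd Ω l t.2 v x))
  + ∑ l, lowerTerms m Ω 1 l l (a l) (a l) u v
  - ∑ p ∈ (Finset.univ : Finset (Fin 3 × Fin 3)).filter (fun p => p.1 < p.2),
      (lowerTerms m Ω (e p.1 * e p.2) p.1 p.2 (a p.1) (a p.2) u v
        - lowerTerms m Ω (e p.1 * e p.2) p.2 p.1 (a p.2) (a p.1) u v)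
  - (2 * s.re) • l2Inner Ω (opT m Ω a u) v

/-- `u` is a weak solution, in `H^m_0`, of the boundary value problem `Q_s(T) u = F`. -/
def IsWeakSolution (m : ℕ) (Ω : Set E3) (a : Fin 3 → E3 → ℝ) (s : ℍ[ℝ]) (F u : L2 Ω) : Prop :=
  MemH0 m Ω u ∧ ∀ v, MemH0 m Ω v → bForm m Ω a s u v = l2Inner Ω F v

/-! ### The constants -/

/-- `C_T = min_l inf_{x ∈ Ω} a_l(x)²`. -/
def constCT (Ω : Set E3) (a : Fin 3 → E3 → ℝ) : ℝ :=
  sInf {y : ℝ | ∃ l, ∃ x ∈ Ω, y = a l x ^ 2}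

/-- The supremum of `|∂_{x_j}^t a_l(x)|` over `t = 1, …, m`, `j, l = 1, 2, 3` and `x ∈ Ω`. -/
def derivSup (m : ℕ) (Ω : Set E3) (a : Fin 3 → E3 → ℝ) : ℝ :=
  sSup {y : ℝ | ∃ t ∈ Finset.Icc 1 m, ∃ j l, ∃ x ∈ Ω, y = |(pd j)^[t] (a l) x|}

/-- `K(m, Ω) = κ max(C_Ω, C_Ω^m)`, where `κ` is a constant depending only on `m`. -/
def constK (κ : ℝ) (m : ℕ) (Ω : Set E3) : ℝ :=
  κ * max (poincareConst Ω) (poincareConst Ω ^ m)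

/-- `M = K(m, Ω)² (sup |∂_{x_j}^t a_l|)²`. -/
def constM (κ : ℝ) (m : ℕ) (Ω : Set E3) (a : Fin 3 → E3 → ℝ) : ℝ :=
  constK κ m Ω ^ 2 * derivSup m Ω a ^ 2

end QuatOp

end

/-! Write S u = ∑ e_j a_j ∂_j^m u (`opS`) and S' v = ∑ e_l ∂_l^m(a_l v) (`adjS`), so that T =
i^(m-1) S, with formal adjoint i^(m-1) S'. For Re s = 0 the long form collapses to b_s(u,v) = |s|²
⟨u,v⟩ + ⟨S u, S' v⟩ (`bForm_eq`). Two facts give this: Leibniz identities, which turn the terms of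
`lowerTerms` into g ∂_l^m(f v) - ∂_l^m(f g v), and the symmetry ⟨q ∂_l^m u, ∂_j^m(A v)⟩ = ⟨q ∂_j^m
u, ∂_l^m(A v)⟩ (`pairing_leib_swap`), which cancels the remainders for l ≠ j.

The difference S' - S contains only terms with at least one derivative on a coefficient, hence at
most m-1 on u. Iterated Poincaré inequalities bound it by a small multiple of |u|_m = (∑ ‖∂_l^m
u‖²)^(1/2) (`norm_adjS_sub_opS_le`). Conversely ‖S u‖ controls |u|_m (`le_norm_opS`): each a_l has
constant sign σ_l because Ω is connected, and S u is paired with ∑ σ_j e_j ∂_j^m u. The diagonal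
terms are at least √C_T ‖∂_l^m u‖². The cross terms are of lower order, because e_l e_j is skew
while the swap above is symmetric.

If κ is large, then ‖S' u - S u‖ ≤ ½ ‖S u‖, so Re b_s(u,u) ≥ |s|² ‖u‖² + ½ ‖S u‖² (`le_reForm`).
Both estimates follow, since C_1 ≤ ½. So does coercivity on H^m_0, and Lax–Milgram solves the real
problem Re b_s(u,v) = Re ⟨F,v⟩. Replacing v by v r for quaternions r recovers the quaternionic
equation.

The analysis takes place on `H0`, the closure of the jets of test functions. There every derivative
is a continuous map, and closed statements need checking only on test functions. `memH0_der` and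
`exists_der_eq` identify it with H^m_0. -/

noncomputable section

namespace QuatOp

section Calculus

variable {F G W : Type*} [NormedAddCommGroup F] [NormedSpace ℝ F]
  [NormedAddCommGroup G] [NormedSpace ℝ G] [NormedAddCommGroup W] [NormedSpace ℝ W]
  {Ω : Set E3}

/-! ### Partial derivatives -/

lemma contDiffOn_pd (hΩ : IsOpen Ω) {k n : WithTop ℕ∞} {f : E3 → F} (h : ContDiffOn ℝ k f Ω)
    (hn : n + 1 ≤ k) (l : Fin 3) : ContDiffOn ℝ n (pd l f) Ω :=
  (h.fderiv_of_isOpen hΩ hn).clm_apply contDiffOn_const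

lemma contDiffOn_iterate_pd (hΩ : IsOpen Ω) (l : Fin 3) (t : ℕ) :
    ∀ {n : ℕ} {f : E3 → F}, ContDiffOn ℝ (n + t : ℕ) f Ω →
      ContDiffOn ℝ n ((pd l)^[t] f) Ω := by
  induction t with
  | zero => intro n f h; simpa using h
  | succ t ih =>
    intro n f h
    rw [Function.iterate_succ_apply]
    refine ih (contDiffOn_pd hΩ h ?_ l)
    norm_cast

lemma contDiff_pd {f : E3 → F} (h : ContDiff ℝ ∞ f) (l : Fin 3) : ContDiff ℝ ∞ (pd l f) :=
  (h.fderiv_right (m := ∞) (by simp)).clm_apply contDiff_const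

lemma contDiff_iterate_pd {f : E3 → F} (h : ContDiff ℝ ∞ f) (l : Fin 3) (t : ℕ) :
    ContDiff ℝ ∞ ((pd l)^[t] f) := by
  induction t with
  | zero => exact h
  | succ t ih => rw [Function.iterate_succ_apply']; exact contDiff_pd ih l

lemma pd_congr_eqOn (hΩ : IsOpen Ω) {f g : E3 → F} (h : Set.EqOn f g Ω) (l : Fin 3) :
    Set.EqOn (pd l f) (pd l g) Ω := by
  intro x hx
  have : f =ᶠ[𝓝 x] g := h.eventuallyEq_of_mem (hΩ.mem_nhds hx)
  simp only [pd, this.fderiv_eq]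

lemma pd_comm {f : E3 → F} (h : ContDiff ℝ ∞ f) (i j : Fin 3) :
    pd i (pd j f) = pd j (pd i f) := by
  have hd : Differentiable ℝ (fderiv ℝ f) :=
    (h.fderiv_right (m := ∞) (by simp)).differentiable (by simp)
  have key : ∀ (i j : Fin 3) (x : E3), pd i (pd j f) x =
      fderiv ℝ (fderiv ℝ f) x (EuclideanSpace.single i 1) (EuclideanSpace.single j 1) := by
    intro i j x
    have := ((hd x).hasFDerivAt.clm_apply
      (hasFDerivAt_const (EuclideanSpace.single j (1 : ℝ)) x)).fderiv
    unfold pd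
    rw [this]
    simp
  funext x
  rw [key, key]
  exact (h.contDiffAt.isSymmSndFDerivAt (by
    simpa using WithTop.coe_le_coe.mpr (le_top : (2 : ℕ∞) ≤ ⊤))).eq _ _

lemma iterate_pd_comm_pd {f : E3 → F} (h : ContDiff ℝ ∞ f) (i j : Fin 3) (t : ℕ) :
    pd i ((pd j)^[t] f) = (pd j)^[t] (pd i f) := by
  induction t with
  | zero => rfl
  | succ t ih =>
    rw [Function.iterate_succ_apply', Function.iterate_succ_apply', ← ih,
      pd_comm (contDiff_iterate_pd h j t)]

lemma iterate_pd_comm {f : E3 → F} (h : ContDiff ℝ ∞ f) (i j : Fin 3) (s t : ℕ) :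
    (pd i)^[s] ((pd j)^[t] f) = (pd j)^[t] ((pd i)^[s] f) := by
  induction s with
  | zero => rfl
  | succ s ih =>
    rw [Function.iterate_succ_apply', ih, iterate_pd_comm_pd (contDiff_iterate_pd h i s),
      Function.iterate_succ_apply']

lemma contDiff_mpd {f : E3 → F} (h : ContDiff ℝ ∞ f) (β : Fin 3 → ℕ) :
    ContDiff ℝ ∞ (mpd β f) :=
  contDiff_iterate_pd (contDiff_iterate_pd (contDiff_iterate_pd h _ _) _ _) _ _

lemma mpd_zero (f : E3 → F) : mpd 0 f = f := rfl

lemma mpd_single (l : Fin 3) (t : ℕ) (f : E3 → F) : mpd (Pi.single l t) f = (pd l)^[t] f := by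
  fin_cases l <;> simp [mpd]

lemma mpd_add_single {f : E3 → F} (h : ContDiff ℝ ∞ f) (β : Fin 3 → ℕ) (l : Fin 3) :
    mpd (β + Pi.single l 1) f = pd l (mpd β f) := by
  have h2 := contDiff_iterate_pd h 2 (β 2)
  have h1 := contDiff_iterate_pd h2 1 (β 1)
  fin_cases l
  · simp [mpd, Function.iterate_succ_apply']
  · simp [mpd, Function.iterate_succ_apply', iterate_pd_comm_pd h1]
  · simp [mpd, Function.iterate_succ_apply', iterate_pd_comm_pd h1, iterate_pd_comm_pd h2]

lemma pd_clm_comp {f : E3 → F} (L : F →L[ℝ] G) (h : ContDiff ℝ ∞ f) (l : Fin 3) :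
    pd l (fun x => L (f x)) = fun x => L (pd l f x) := by
  funext x
  have := (L.hasFDerivAt.comp x (h.differentiable (by simp) x).hasFDerivAt).fderiv
  unfold pd
  rw [show (fun x => L (f x)) = L ∘ f from rfl, this]
  rfl

lemma iterate_pd_clm_comp {f : E3 → F} (L : F →L[ℝ] G) (h : ContDiff ℝ ∞ f) (l : Fin 3) (t : ℕ) :
    (pd l)^[t] (fun x => L (f x)) = fun x => L ((pd l)^[t] f x) := by
  induction t with
  | zero => rfl
  | succ t ih =>
    rw [Function.iterate_succ_apply', Function.iterate_succ_apply', ih,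
      pd_clm_comp L (contDiff_iterate_pd h l t)]

lemma mpd_clm_comp {f : E3 → F} (L : F →L[ℝ] G) (h : ContDiff ℝ ∞ f) (β : Fin 3 → ℕ) :
    mpd β (fun x => L (f x)) = fun x => L (mpd β f x) := by
  have h2 := contDiff_iterate_pd h 2 (β 2)
  have h1 := contDiff_iterate_pd h2 1 (β 1)
  unfold mpd
  rw [iterate_pd_clm_comp L h, iterate_pd_clm_comp L h2, iterate_pd_clm_comp L h1]

lemma pd_add {f g : E3 → F} (hf : ContDiff ℝ ∞ f) (hg : ContDiff ℝ ∞ g) (l : Fin 3) :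
    pd l (f + g) = pd l f + pd l g := by
  funext x
  simp [pd, fderiv_add (hf.differentiable (by simp) x) (hg.differentiable (by simp) x)]

lemma iterate_pd_add {f g : E3 → F} (hf : ContDiff ℝ ∞ f) (hg : ContDiff ℝ ∞ g) (l : Fin 3)
    (t : ℕ) : (pd l)^[t] (f + g) = (pd l)^[t] f + (pd l)^[t] g := by
  induction t with
  | zero => rfl
  | succ t ih =>
    simp only [Function.iterate_succ_apply', ih,
      pd_add (contDiff_iterate_pd hf l t) (contDiff_iterate_pd hg l t)]

lemma mpd_add {f g : E3 → F} (hf : ContDiff ℝ ∞ f) (hg : ContDiff ℝ ∞ g) (β : Fin 3 → ℕ) :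
    mpd β (f + g) = mpd β f + mpd β g := by
  have hf2 := contDiff_iterate_pd hf 2 (β 2)
  have hf1 := contDiff_iterate_pd hf2 1 (β 1)
  have hg2 := contDiff_iterate_pd hg 2 (β 2)
  have hg1 := contDiff_iterate_pd hg2 1 (β 1)
  unfold mpd
  rw [iterate_pd_add hf hg, iterate_pd_add hf2 hg2, iterate_pd_add hf1 hg1]

/-! ### Supports -/

lemma tsupport_pd_subset (f : E3 → F) (l : Fin 3) : tsupport (pd l f) ⊆ tsupport f :=
  tsupport_fderiv_apply_subset ℝ _

lemma tsupport_iterate_pd_subset (f : E3 → F) (l : Fin 3) (t : ℕ) :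
    tsupport ((pd l)^[t] f) ⊆ tsupport f := by
  induction t with
  | zero => exact subset_rfl
  | succ t ih =>
    rw [Function.iterate_succ_apply']
    exact (tsupport_pd_subset _ l).trans ih

lemma tsupport_mpd_subset (f : E3 → F) (β : Fin 3 → ℕ) : tsupport (mpd β f) ⊆ tsupport f :=
  ((tsupport_iterate_pd_subset _ _ _).trans (tsupport_iterate_pd_subset _ _ _)).trans
    (tsupport_iterate_pd_subset _ _ _)

lemma IsTest.of_tsupport_subset {φ : E3 → F} {ψ : E3 → G} (h : IsTest Ω φ) (hψ : ContDiff ℝ ∞ ψ)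
    (hs : tsupport ψ ⊆ tsupport φ) : IsTest Ω ψ :=
  ⟨hψ, h.2.1.of_isClosed_subset (isClosed_tsupport _) hs, hs.trans h.2.2⟩

lemma IsTest.mpd {φ : E3 → F} (h : IsTest Ω φ) (β : Fin 3 → ℕ) : IsTest Ω (mpd β φ) :=
  h.of_tsupport_subset (contDiff_mpd h.1 β) (tsupport_mpd_subset φ β)

lemma IsTest.iterate_pd {φ : E3 → F} (h : IsTest Ω φ) (l : Fin 3) (t : ℕ) :
    IsTest Ω ((pd l)^[t] φ) :=
  h.of_tsupport_subset (contDiff_iterate_pd h.1 l t) (tsupport_iterate_pd_subset φ l t)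

lemma IsTest.pd {φ : E3 → F} (h : IsTest Ω φ) (l : Fin 3) : IsTest Ω (pd l φ) :=
  h.iterate_pd l 1

lemma IsTest.clm_comp {φ : E3 → F} (L : F →L[ℝ] G) (h : IsTest Ω φ) :
    IsTest Ω (fun x => L (φ x)) := by
  refine h.of_tsupport_subset (L.contDiff.comp h.1) (closure_mono fun x hx => ?_)
  contrapose! hx
  simp_all

lemma IsTest.add {φ ψ : E3 → F} (hφ : IsTest Ω φ) (hψ : IsTest Ω ψ) : IsTest Ω (φ + ψ) :=
  ⟨hφ.1.add hψ.1, hφ.2.1.add hψ.2.1,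
    (tsupport_add φ ψ).trans (Set.union_subset hφ.2.2 hψ.2.2)⟩

lemma IsTest.eq_zero {φ : E3 → F} (h : IsTest Ω φ) {x : E3} (hx : x ∉ Ω) : φ x = 0 :=
  image_eq_zero_of_notMem_tsupport fun hx' => hx (h.2.2 hx')

lemma isTest_zero : IsTest Ω (0 : E3 → F) := by
  refine ⟨contDiff_const, HasCompactSupport.zero, ?_⟩
  simp [tsupport]

/-- Nothing is known about A outside Ω, but the product vanishes near every point outside the
support of ψ. -/
lemma contDiff_smul_of_contDiffOn (hΩ : IsOpen Ω) {n : ℕ} {A : E3 → ℝ} {ψ : E3 → F}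
    (hA : ContDiffOn ℝ n A Ω) (hψ : IsTest Ω ψ) : ContDiff ℝ n (fun x => A x • ψ x) := by
  rw [contDiff_iff_contDiffAt]
  intro x
  by_cases hx : x ∈ Ω
  · exact (hA.contDiffAt (hΩ.mem_nhds hx)).smul (hψ.1.contDiffAt.of_le (by exact_mod_cast le_top))
  · have hx' : x ∉ tsupport ψ := fun h => hx (hψ.2.2 h)
    have : (fun x => A x • ψ x) =ᶠ[𝓝 x] fun _ => (0 : F) := by
      filter_upwards [(notMem_tsupport_iff_eventuallyEq.mp hx')] with y hy
      simp [hy]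
    exact contDiffAt_const.congr_of_eventuallyEq this

lemma iterate_pd_smul (hΩ : IsOpen Ω) (l : Fin 3) {f : E3 → ℝ} {g : E3 → F} (n : ℕ)
    (hf : ContDiffOn ℝ n f Ω) (hg : ContDiffOn ℝ n g Ω) {x : E3} (hx : x ∈ Ω) :
    (pd l)^[n] (fun y => f y • g y) x = ∑ t ∈ Finset.HasAntidiagonal.antidiagonal n,
      (n.choose t.1 : ℝ) • ((pd l)^[t.1] f x • (pd l)^[t.2] g x) := by
  induction n generalizing x with
  | zero => simp
  | succ n ih =>
    have ih' := fun (y : E3) (hy : y ∈ Ω) => ih (hf.of_le (by norm_cast; omega))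
      (hg.of_le (by norm_cast; omega)) hy
    rw [Function.iterate_succ_apply', pd_congr_eqOn hΩ (fun y hy => ih' y hy) l hx]
    have hdf : ∀ t ≤ n, DifferentiableAt ℝ ((pd l)^[t] f) x := fun t ht =>
      ((contDiffOn_iterate_pd hΩ l t (n := 1) (hf.of_le (by norm_cast; omega))).differentiableOn
        (by simp)).differentiableAt (hΩ.mem_nhds hx)
    have hdg : ∀ t ≤ n, DifferentiableAt ℝ ((pd l)^[t] g) x := fun t ht =>
      ((contDiffOn_iterate_pd hΩ l t (n := 1) (hg.of_le (by norm_cast; omega))).differentiableOn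
        (by simp)).differentiableAt (hΩ.mem_nhds hx)
    have hsum := (HasFDerivAt.fun_sum (u := Finset.HasAntidiagonal.antidiagonal n)
      (A := fun t y => (n.choose t.1 : ℝ) • ((pd l)^[t.1] f y • (pd l)^[t.2] g y)) (x := x)
      (fun t ht => by
        have ht' := Finset.HasAntidiagonal.mem_antidiagonal.mp ht
        exact ((hdf t.1 (by omega)).hasFDerivAt.smul (hdg t.2 (by omega)).hasFDerivAt).const_smul
          (n.choose t.1 : ℝ))).fderiv
    unfold pd at hsum ⊢
    rw [hsum]
    have hp := Finset.sum_antidiagonal_choose_succ_nsmul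
      (fun i j => (pd l)^[i] f x • (pd l)^[j] g x) n
    simp only [← Nat.cast_smul_eq_nsmul ℝ] at hp
    unfold pd at hp
    rw [hp, _root_.sum_apply, ← Finset.sum_add_distrib]
    refine Finset.sum_congr rfl fun t ht => ?_
    have ht' := Finset.HasAntidiagonal.mem_antidiagonal.mp ht
    -- The Pascal-type summation formula has `t.2` in one of its two binomials; symmetry of
    -- binomials makes the two agree.
    rw [show n.choose t.2 = n.choose t.1 from
      Nat.choose_symm_of_eq_add (by omega)]
    simp [Function.iterate_succ_apply', smul_add]

/-! ### Integration by parts -/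

lemma integrable_bilin (B : F →L[ℝ] G →L[ℝ] W) {f : E3 → F} {g : E3 → G} (hf : Continuous f)
    (hfc : HasCompactSupport f) (hg : Continuous g) :
    Integrable (fun x => B (f x) (g x)) := by
  refine Continuous.integrable_of_hasCompactSupport (by fun_prop) (hfc.mono fun x hx => ?_)
  contrapose! hx
  simp_all

lemma integral_bilin_pd (B : F →L[ℝ] G →L[ℝ] W) {f : E3 → F} {g : E3 → G} (hf : ContDiff ℝ 1 f)
    (hfc : HasCompactSupport f) (hg : ContDiff ℝ 1 g) (l : Fin 3) :
    ∫ x, B (f x) (pd l g x) = - ∫ x, B (pd l f x) (g x) := by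
  have hcf : Continuous (pd l f) :=
    (hf.continuous_fderiv (by simp)).clm_apply continuous_const
  have hcg : Continuous (pd l g) :=
    (hg.continuous_fderiv (by simp)).clm_apply continuous_const
  have hcs : HasCompactSupport (pd l f) :=
    hfc.of_isClosed_subset (isClosed_tsupport _) (tsupport_pd_subset f l)
  exact integral_bilinear_hasLineDerivAt_right_eq_neg_left_of_integrable
    (integrable_bilin B hcf hcs hg.continuous) (integrable_bilin B hf.continuous hfc hcg)
    (integrable_bilin B hf.continuous hfc hg.continuous)
    (fun x _ => (hf.differentiable (by simp) x).hasFDerivAt.hasLineDerivAt _)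
    (fun x _ => (hg.differentiable (by simp) x).hasFDerivAt.hasLineDerivAt _)

lemma integral_bilin_iterate_pd (B : F →L[ℝ] G →L[ℝ] W) {f : E3 → F} {g : E3 → G} (n : ℕ)
    (hf : ContDiff ℝ ∞ f) (hfc : HasCompactSupport f) (hg : ContDiff ℝ n g) (l : Fin 3) :
    ∫ x, B (f x) ((pd l)^[n] g x) = (-1 : ℝ) ^ n • ∫ x, B ((pd l)^[n] f x) (g x) := by
  induction n generalizing g with
  | zero => simp
  | succ n ih =>
    have h1 : ContDiff ℝ n (pd l g) :=
      contDiffOn_univ.mp (contDiffOn_pd isOpen_univ hg.contDiffOn (by norm_cast) l)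
    rw [Function.iterate_succ_apply, ih h1, Function.iterate_succ_apply', integral_bilin_pd B
      ((contDiff_iterate_pd hf l n).of_le (by simp))
      (hfc.of_isClosed_subset (isClosed_tsupport _) (tsupport_iterate_pd_subset f l n))
      (hg.of_le (by norm_cast; omega)), pow_succ]
    simp

/-- All derivatives are moved onto f, which is smooth, and commuted there; the two signs (-1)^n
agree. Since g is only C^n, they could not be moved onto g. -/
lemma integral_bilin_iterate_pd_swap (B : F →L[ℝ] G →L[ℝ] W) {f : E3 → F} {g : E3 → G} (n : ℕ)
    (hf : ContDiff ℝ ∞ f) (hfc : HasCompactSupport f) (hg : ContDiff ℝ n g) (l j : Fin 3) :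
    ∫ x, B ((pd l)^[n] f x) ((pd j)^[n] g x) = ∫ x, B ((pd j)^[n] f x) ((pd l)^[n] g x) := by
  have hs : ∀ i, HasCompactSupport ((pd i)^[n] f) := fun i =>
    hfc.of_isClosed_subset (isClosed_tsupport _) (tsupport_iterate_pd_subset f i n)
  rw [integral_bilin_iterate_pd B n (contDiff_iterate_pd hf l n) (hs l) hg,
    integral_bilin_iterate_pd B n (contDiff_iterate_pd hf j n) (hs j) hg, iterate_pd_comm hf]

/-- Both sides are `∫ B(φ, ∂_l^m ∂_j^m (A ψ))`, up to sign, expanded by the Leibniz rule. -/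
lemma setIntegral_leibniz_swap (hΩ : IsOpen Ω) (B : F →L[ℝ] G →L[ℝ] W) (m : ℕ) {A : E3 → ℝ}
    (hA : ContDiffOn ℝ m A Ω) {φ : E3 → F} {ψ : E3 → G} (hφ : IsTest Ω φ) (hψ : IsTest Ω ψ)
    (l j : Fin 3) :
    ∫ x in Ω, B ((pd l)^[m] φ x) (∑ t ∈ Finset.HasAntidiagonal.antidiagonal m,
        (m.choose t.1 : ℝ) • ((pd j)^[t.1] A x • (pd j)^[t.2] ψ x)) =
      ∫ x in Ω, B ((pd j)^[m] φ x) (∑ t ∈ Finset.HasAntidiagonal.antidiagonal m,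
        (m.choose t.1 : ℝ) • ((pd l)^[t.1] A x • (pd l)^[t.2] ψ x)) := by
  have key : ∀ i k : Fin 3, ∫ x in Ω, B ((pd i)^[m] φ x)
      (∑ t ∈ Finset.HasAntidiagonal.antidiagonal m,
        (m.choose t.1 : ℝ) • ((pd k)^[t.1] A x • (pd k)^[t.2] ψ x)) =
      ∫ x, B ((pd i)^[m] φ x) ((pd k)^[m] (fun y => A y • ψ y) x) := by
    intro i k
    have h0 : ∀ x ∉ Ω, B ((pd i)^[m] φ x) ((pd k)^[m] (fun y => A y • ψ y) x) = 0 :=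
      fun x hx => by simp [(hφ.iterate_pd i m).eq_zero hx]
    rw [← setIntegral_eq_integral_of_forall_compl_eq_zero h0]
    refine setIntegral_congr_fun hΩ.measurableSet fun x hx => ?_
    rw [iterate_pd_smul hΩ k m hA (hψ.1.contDiffOn.of_le (by exact_mod_cast le_top)) hx]
  rw [key, key]
  exact integral_bilin_iterate_pd_swap B m hφ.1 hφ.2.1 (contDiff_smul_of_contDiffOn hΩ hA hψ) l j

end Calculus

/-! ### The Poincaré inequality and mixed derivatives -/

section Poincare

variable {Ω : Set E3} {H : Type*} [NormedAddCommGroup H] [InnerProductSpace ℝ H]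

/-- The scalar product of a real inner product space as a continuous bilinear map. -/
def realInner : H →L[ℝ] H →L[ℝ] ℝ := innerSL ℝ

lemma realInner_apply (v w : H) : realInner v w = inner ℝ v w := rfl

lemma IsTest.integrable_norm_sq {φ : E3 → H} (h : IsTest Ω φ) :
    Integrable (fun x => ‖φ x‖ ^ 2) := by
  have := integrable_bilin realInner h.1.continuous h.2.1 h.1.continuous
  simpa only [realInner_apply, real_inner_self_eq_norm_sq] using this

/-- Integrating φ² ∂_0 x_0 by parts gives ∫ φ² = -2 ∫ x_0 φ ∂_0 φ ≤ ½ ∫ φ² + 2R² ∫ |∇φ|², where R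
bounds |x| on Ω. Absorbing the first term yields the constant 2|R|. -/
lemma exists_poincare (hb : Bornology.IsBounded Ω) :
    ∃ C : ℝ, 0 ≤ C ∧ ∀ φ : E3 → ℝ, IsTest Ω φ →
      ∫ x in Ω, φ x ^ 2 ≤ C ^ 2 * ∫ x in Ω, ∑ l, pd l φ x ^ 2 := by
  obtain ⟨R, hR⟩ := hb.exists_norm_le
  refine ⟨2 * |R|, by positivity, fun φ hφ => ?_⟩
  have hsq : ∀ {ψ : E3 → ℝ}, IsTest Ω ψ → Integrable (fun x => ψ x ^ 2) := fun h => by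
    simpa using h.integrable_norm_sq
  let g : E3 →L[ℝ] ℝ := EuclideanSpace.proj 0
  have hg : ∀ x, pd 0 g x = 1 := fun x => by
    unfold pd
    rw [g.fderiv]
    simp [g]
  have hp : ∀ x, pd 0 (fun y => φ y * φ y) x = 2 * (φ x * pd 0 φ x) := fun x => by
    have := ((hφ.1.differentiable (by simp) x).hasFDerivAt.mul
      (hφ.1.differentiable (by simp) x).hasFDerivAt).fderiv
    unfold pd
    rw [show (fun y => φ y * φ y) = φ * φ from rfl, this]
    simp
    ring
  have hibp := integral_bilin_pd (ContinuousLinearMap.mul ℝ ℝ) (f := fun y => φ y * φ y) (g := g)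
    ((hφ.1.mul hφ.1).of_le (by simp)) (hφ.2.1.mul_left) g.contDiff 0
  simp only [ContinuousLinearMap.mul_apply', hg, mul_one, hp] at hibp
  have h0 : ∀ x ∉ Ω, φ x ^ 2 = 0 := fun x hx => by simp [hφ.eq_zero hx]
  have h1 : ∀ x ∉ Ω, ∑ l, pd l φ x ^ 2 = 0 := fun x hx => by simp [(hφ.pd _).eq_zero hx]
  rw [setIntegral_eq_integral_of_forall_compl_eq_zero h0,
    setIntegral_eq_integral_of_forall_compl_eq_zero h1]
  have hint1 := hsq hφ
  have hint2 : Integrable (fun x => ∑ l, pd l φ x ^ 2) :=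
    integrable_finsetSum _ fun l _ => hsq (hφ.pd l)
  have hmono : ∫ x, φ x * φ x ≤
      ∫ x, (1 / 2 * φ x ^ 2 + 2 * |R| ^ 2 * ∑ l, pd l φ x ^ 2) := by
    rw [hibp, ← integral_neg]
    have hint3 : Integrable (fun x => 2 * (φ x * pd 0 φ x) * g x) := by
      have h := integrable_bilin (ContinuousLinearMap.mul ℝ ℝ)
        (f := fun x => 2 * (φ x * pd 0 φ x)) (g := g)
        (continuous_const.mul (hφ.1.continuous.mul (hφ.pd 0).1.continuous))
        (hφ.2.1.mul_right.mul_left) g.continuous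
      simpa using h
    refine integral_mono hint3.neg ((hint1.const_mul _).add (hint2.const_mul _)) fun x => ?_
    by_cases hx : x ∈ Ω
    · have hgx : |g x| ≤ |R| :=
        ((PiLp.norm_apply_le x 0).trans (hR x hx)).trans (le_abs_self R)
      have h2 : pd 0 φ x ^ 2 ≤ ∑ l, pd l φ x ^ 2 :=
        Finset.single_le_sum (f := fun l => pd l φ x ^ 2) (fun _ _ => sq_nonneg _)
          (Finset.mem_univ 0)
      have h3 : (g x) ^ 2 ≤ |R| ^ 2 := sq_le_sq' (by linarith [neg_abs_le (g x)])
        ((le_abs_self _).trans hgx)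
      have h4 : g x ^ 2 * pd 0 φ x ^ 2 ≤ |R| ^ 2 * ∑ l, pd l φ x ^ 2 := by gcongr
      simp only
      nlinarith [sq_nonneg (φ x + 2 * (pd 0 φ x * g x))]
    · simp only [hφ.eq_zero hx]
      have : 0 ≤ ∑ l, pd l φ x ^ 2 := Finset.sum_nonneg fun _ _ => sq_nonneg _
      simp
      positivity
  rw [integral_add (hint1.const_mul _) (hint2.const_mul _), integral_const_mul,
    integral_const_mul] at hmono
  simp only [← pow_two] at hmono
  linarith

lemma poincareConst_nonneg : 0 ≤ poincareConst Ω :=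
  Real.sInf_nonneg fun _ h => h.1

/-- The infimum is attained: for fixed φ the admissible C form a closed set. -/
lemma integral_sq_le_poincareConst (hb : Bornology.IsBounded Ω) {φ : E3 → ℝ} (hφ : IsTest Ω φ) :
    ∫ x in Ω, φ x ^ 2 ≤ poincareConst Ω ^ 2 * ∫ x in Ω, ∑ l, pd l φ x ^ 2 := by
  have hmem : poincareConst Ω ∈ closure {C : ℝ | 0 ≤ C ∧ ∀ φ : E3 → ℝ, IsTest Ω φ →
      ∫ x in Ω, φ x ^ 2 ≤ C ^ 2 * ∫ x in Ω, ∑ l, pd l φ x ^ 2} :=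
    csInf_mem_closure (exists_poincare hb) ⟨0, fun _ h => h.1⟩
  have hcl : IsClosed {C : ℝ | ∫ x in Ω, φ x ^ 2 ≤ C ^ 2 * ∫ x in Ω, ∑ l, pd l φ x ^ 2} :=
    isClosed_le continuous_const (by fun_prop)
  exact closure_minimal (fun C hC => hC.2 φ hφ) hcl hmem

lemma integral_norm_sq_le_poincareConst [FiniteDimensional ℝ H] (hb : Bornology.IsBounded Ω)
    {φ : E3 → H} (hφ : IsTest Ω φ) :
    ∫ x in Ω, ‖φ x‖ ^ 2 ≤ poincareConst Ω ^ 2 * ∑ l, ∫ x in Ω, ‖pd l φ x‖ ^ 2 := by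
  let b := stdOrthonormalBasis ℝ H
  have hn : ∀ v : H, ‖v‖ ^ 2 = ∑ i, (realInner (b i) v) ^ 2 := fun v => by
    simpa [realInner_apply] using (b.sum_sq_norm_inner_right v).symm
  have ht : ∀ i, IsTest Ω (fun x => realInner (b i) (φ x)) := fun i => hφ.clm_comp _
  have hpd : ∀ i l x, pd l (fun x => realInner (b i) (φ x)) x = realInner (b i) (pd l φ x) :=
    fun i l x => congrFun (pd_clm_comp (realInner (b i)) hφ.1 l) x
  have hsq : ∀ {ψ : E3 → ℝ}, IsTest Ω ψ → IntegrableOn (fun x => ψ x ^ 2) Ω := fun h => by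
    simpa using h.integrable_norm_sq.integrableOn (s := Ω)
  have h1 : ∫ x in Ω, ‖φ x‖ ^ 2 = ∑ i, ∫ x in Ω, (realInner (b i) (φ x)) ^ 2 := by
    simp_rw [hn]
    exact integral_finsetSum _ fun i _ => hsq (ht i)
  have h2 : ∀ l, ∫ x in Ω, ‖pd l φ x‖ ^ 2 =
      ∑ i, ∫ x in Ω, (pd l (fun x => realInner (b i) (φ x)) x) ^ 2 := by
    intro l
    simp_rw [hn, ← hpd]
    exact integral_finsetSum _ fun i _ => hsq ((ht i).pd l)
  rw [h1, Finset.sum_congr rfl fun l _ => h2 l, Finset.sum_comm, Finset.mul_sum]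
  refine Finset.sum_le_sum fun i _ => ?_
  refine (integral_sq_le_poincareConst hb (ht i)).trans_eq ?_
  rw [integral_finsetSum _ fun l _ => hsq ((ht i).pd l)]

/-- Two integrations by parts give ∫ |∂_i ∂_j f|² = ∫ ⟨∂_i² f, ∂_j² f⟩ for f = ∂^γ φ; then 2⟨a,b⟩ ≤
|a|² + |b|². -/
lemma setIntegral_norm_sq_mixed_le {φ : E3 → H} (hφ : IsTest Ω φ)
    (γ : Fin 3 → ℕ) (i j : Fin 3) :
    2 * ∫ x in Ω, ‖mpd (γ + Pi.single i 1 + Pi.single j 1) φ x‖ ^ 2 ≤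
      (∫ x in Ω, ‖mpd (γ + Pi.single i 1 + Pi.single i 1) φ x‖ ^ 2) +
        ∫ x in Ω, ‖mpd (γ + Pi.single j 1 + Pi.single j 1) φ x‖ ^ 2 := by
  have h0 : ∀ β, ∫ x in Ω, ‖mpd β φ x‖ ^ 2 = ∫ x, ‖mpd β φ x‖ ^ 2 := fun β =>
    setIntegral_eq_integral_of_forall_compl_eq_zero
      (fun x hx => by simp [(hφ.mpd β).eq_zero hx])
  simp only [h0]
  have hsm := contDiff_mpd hφ.1
  have hex : ∫ x, ‖mpd (γ + Pi.single i 1 + Pi.single j 1) φ x‖ ^ 2 =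
      ∫ x, realInner (mpd (γ + Pi.single i 1 + Pi.single i 1) φ x)
        (mpd (γ + Pi.single j 1 + Pi.single j 1) φ x) := by
    have := integral_bilin_iterate_pd_swap realInner 1 (hsm (γ + Pi.single i 1))
      (hφ.mpd _).2.1 ((hsm (γ + Pi.single j 1)).of_le (by simp)) j i
    simp only [Function.iterate_one, ← mpd_add_single hφ.1] at this
    rw [← this, add_right_comm γ (Pi.single j 1)]
    simp [realInner_apply]
  rw [hex, ← integral_const_mul, ← integral_add (hφ.mpd _).integrable_norm_sq
    (hφ.mpd _).integrable_norm_sq]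
  refine integral_mono ((integrable_bilin realInner (hsm _).continuous (hφ.mpd _).2.1
    (hsm _).continuous).const_mul 2) ((hφ.mpd _).integrable_norm_sq.add
    (hφ.mpd _).integrable_norm_sq) fun x => ?_
  simp only [realInner_apply]
  nlinarith [norm_sub_sq_real (mpd (γ + Pi.single i 1 + Pi.single i 1) φ x)
    (mpd (γ + Pi.single j 1 + Pi.single j 1) φ x),
    sq_nonneg ‖mpd (γ + Pi.single i 1 + Pi.single i 1) φ x -
      mpd (γ + Pi.single j 1 + Pi.single j 1) φ x‖]

/-- A function on multi-indices that is midpoint convex in the directions `e_i - e_j` is at most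
its maximum over the vertices `n e_l`, on the simplex of multi-indices of order `n`. -/
lemma le_of_le_single (N : (Fin 3 → ℕ) → ℝ)
    (hN : ∀ (γ : Fin 3 → ℕ) (i j : Fin 3), 2 * N (γ + Pi.single i 1 + Pi.single j 1) ≤
      N (γ + Pi.single i 1 + Pi.single i 1) + N (γ + Pi.single j 1 + Pi.single j 1))
    {n : ℕ} {c : ℝ} (hc : ∀ l, N (Pi.single l n) ≤ c) {β : Fin 3 → ℕ} (hβ : ∑ i, β i = n) :
    N β ≤ c := by
  let T := Finset.Nat.antidiagonalTuple 3 n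
  have hT : ∀ {γ}, γ ∈ T ↔ ∑ i, γ i = n := Finset.Nat.mem_antidiagonalTuple
  obtain ⟨α, hαT, hα⟩ := T.exists_max_image N ⟨β, hT.2 hβ⟩
  -- Among the maximisers of N, one with the largest sum of squares is chosen. If it had two nonzero
  -- entries, midpoint convexity would make both neighbours maximisers, and one of them would have a
  -- larger sum of squares.
  obtain ⟨δ, hδ, hmax⟩ := (T.filter fun γ => N γ = N α).exists_max_image (fun γ => ∑ i, γ i ^ 2)
    ⟨α, by simp [hαT]⟩
  obtain ⟨hδT, hδα⟩ := Finset.mem_filter.1 hδ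
  refine (hα β (hT.2 hβ)).trans (hδα ▸ ?_)
  have hδn := hT.1 hδT
  by_cases hex : ∃ i j : Fin 3, i ≠ j ∧ δ i ≠ 0 ∧ δ j ≠ 0
  · exfalso
    obtain ⟨i, j, hij, hi, hj⟩ := hex
    obtain ⟨γ, rfl⟩ : ∃ γ : Fin 3 → ℕ, δ = γ + Pi.single i 1 + Pi.single j 1 := by
      refine ⟨δ - Pi.single i 1 - Pi.single j 1, ?_⟩
      ext k
      simp only [Pi.add_apply, Pi.sub_apply, Pi.single_apply]
      split_ifs with h1 h2 h2
      · exact absurd (h1.symm.trans h2) hij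
      · subst h1; omega
      · subst h2; omega
      · omega
    have h1 : ∀ k : Fin 3, γ + Pi.single k 1 + Pi.single k 1 ∈ T := fun k => by
      rw [hT, ← hδn]
      simp [Finset.sum_add_distrib]
    have e1 := hα _ (h1 i)
    have e2 := hα _ (h1 j)
    have e3 := hN γ i j
    have f1 := hmax _ (Finset.mem_filter.2 ⟨h1 i, by linarith⟩)
    have f2 := hmax _ (Finset.mem_filter.2 ⟨h1 j, by linarith⟩)
    simp only [Fin.sum_univ_three] at f1 f2
    fin_cases i <;> fin_cases j <;> simp at f1 f2 hij <;> nlinarith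
  · push Not at hex
    have : ∃ l, δ = Pi.single l n := by
      by_cases h0 : δ 0 = 0
      · by_cases h1 : δ 1 = 0
        · refine ⟨2, ?_⟩
          simp only [Fin.sum_univ_three] at hδn
          ext k; fin_cases k <;> simp <;> omega
        · refine ⟨1, ?_⟩
          have := hex 1 2 (by decide) h1
          simp only [Fin.sum_univ_three] at hδn
          ext k; fin_cases k <;> simp <;> omega
      · refine ⟨0, ?_⟩
        have := hex 0 1 (by decide) h0
        have := hex 0 2 (by decide) h0
        simp only [Fin.sum_univ_three] at hδn
        ext k; fin_cases k <;> simp <;> omega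
    obtain ⟨l, rfl⟩ := this
    exact hc l

/-- Each Poincaré step raises the order by one and costs C_Ω², with a factor 3 for the three
directions. At order m, the convexity lemma `le_of_le_single` replaces mixed derivatives by pure
ones. -/
lemma setIntegral_norm_sq_mpd_le [FiniteDimensional ℝ H] (hb : Bornology.IsBounded Ω)
    {φ : E3 → H} (hφ : IsTest Ω φ) {m : ℕ} (k : ℕ) {β : Fin 3 → ℕ} (hβ : ∑ i, β i + k = m) :
    ∫ x in Ω, ‖mpd β φ x‖ ^ 2 ≤
      (3 * poincareConst Ω ^ 2) ^ k * ∑ l, ∫ x in Ω, ‖mpd (Pi.single l m) φ x‖ ^ 2 := by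
  induction k generalizing β with
  | zero =>
    rw [pow_zero, one_mul]
    refine le_of_le_single (fun β => ∫ x in Ω, ‖mpd β φ x‖ ^ 2)
      (fun γ i j => setIntegral_norm_sq_mixed_le hφ γ i j) (n := m) (fun l => ?_) (by simpa using hβ)
    exact Finset.single_le_sum (f := fun l => ∫ x in Ω, ‖mpd (Pi.single l m) φ x‖ ^ 2)
      (fun i _ => integral_nonneg fun x => by positivity) (Finset.mem_univ l)
  | succ k ih =>
    refine (integral_norm_sq_le_poincareConst hb (hφ.mpd β)).trans ?_
    have : ∀ l, ∫ x in Ω, ‖pd l (mpd β φ) x‖ ^ 2 ≤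
        (3 * poincareConst Ω ^ 2) ^ k * ∑ l, ∫ x in Ω, ‖mpd (Pi.single l m) φ x‖ ^ 2 := by
      intro l
      rw [← mpd_add_single hφ.1]
      refine ih ?_
      simp [Finset.sum_add_distrib]
      omega
    calc poincareConst Ω ^ 2 * ∑ l, ∫ x in Ω, ‖pd l (mpd β φ) x‖ ^ 2
        ≤ poincareConst Ω ^ 2 * ∑ l : Fin 3, ((3 * poincareConst Ω ^ 2) ^ k *
            ∑ l, ∫ x in Ω, ‖mpd (Pi.single l m) φ x‖ ^ 2) := by
          gcongr with l
          exact this l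
      _ = _ := by
          rw [Finset.sum_const, Finset.card_univ, Fintype.card_fin, pow_succ]
          ring

end Poincare

/-! ### Linear algebra of `ℂ ⊗ ℍ` -/

section Algebra

lemma CH.ext {u v : CH} (h₁ : u.fst = v.fst) (h₂ : u.snd = v.snd) : u = v :=
  WithLp.ofLp_injective 2 (Prod.ext h₁ h₂)

lemma norm_chInner_le (u v : CH) : ‖chInner u v‖ ≤ 2 * ‖u‖ * ‖v‖ := by
  have h1 := WithLp.norm_fst_le (p := 2) _ u
  have h2 := WithLp.norm_fst_le (p := 2) _ v
  have h3 := WithLp.norm_snd_le (p := 2) _ u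
  have h4 := WithLp.norm_snd_le (p := 2) _ v
  calc ‖chInner u v‖ ≤ ‖u.fst‖ * ‖v.fst‖ + ‖u.snd‖ * ‖v.snd‖ := by
        refine (norm_add_le _ _).trans ?_
        simp
    _ ≤ ‖u‖ * ‖v‖ + ‖u‖ * ‖v‖ := by gcongr
    _ = 2 * ‖u‖ * ‖v‖ := by ring

/-- `chInner` as a continuous real bilinear map. -/
def chInnerL : CH →L[ℝ] CH →L[ℝ] ℍ[ℝ] :=
  LinearMap.mkContinuous₂ (LinearMap.mk₂ ℝ chInner
    (fun u v w => by simp [chInner, add_mul]; abel)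
    (fun c u v => by simp [chInner])
    (fun u v w => by simp [chInner, mul_add]; abel)
    (fun c u v => by simp [chInner])) 2 norm_chInner_le

lemma chInnerL_apply (u v : CH) : chInnerL u v = chInner u v := rfl

/-- `mulL q` as a continuous real linear map. -/
def mulLL (q : ℍ[ℝ]) : CH →L[ℝ] CH :=
  LinearMap.toContinuousLinearMap
    { toFun := mulL q
      map_add' := fun u v => by apply CH.ext <;> simp [mulL, mul_add]
      map_smul' := fun c u => by apply CH.ext <;> simp [mulL] }

lemma mulLL_apply (q : ℍ[ℝ]) (u : CH) : mulLL q u = mulL q u := rfl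

/-- Right multiplication by a quaternion, as a continuous real linear map. -/
def mulRL (q : ℍ[ℝ]) : CH →L[ℝ] CH :=
  LinearMap.toContinuousLinearMap
    { toFun := fun u => WithLp.toLp 2 (u.fst * q, u.snd * q)
      map_add' := fun u v => by apply CH.ext <;> simp [add_mul]
      map_smul' := fun c u => by apply CH.ext <;> simp }

lemma mulRL_apply (q : ℍ[ℝ]) (u : CH) : mulRL q u = WithLp.toLp 2 (u.fst * q, u.snd * q) := rfl

lemma mulRL_mulL (p q : ℍ[ℝ]) (u : CH) : mulRL p (mulL q u) = mulL q (mulRL p u) := by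
  simp [mulRL_apply, mulL, mul_assoc]

lemma chInner_mulRL (u v : CH) (q : ℍ[ℝ]) : chInner u (mulRL q v) = chInner u v * q := by
  simp [chInner, mulRL_apply, add_mul, mul_assoc]

lemma chInner_mulL (p q : ℍ[ℝ]) (u v : CH) :
    chInner (mulL p u) (mulL q v) = chInner (mulL (star q * p) u) v := by
  simp [chInner, mulL, mul_assoc]

lemma mulL_one (u : CH) : mulL 1 u = u := by apply CH.ext <;> simp [mulL]

lemma mulL_neg (q : ℍ[ℝ]) (u : CH) : mulL (-q) u = - mulL q u := by
  apply CH.ext <;> simp [mulL]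

/-- The real part as a continuous linear map. -/
def reL : ℍ[ℝ] →L[ℝ] ℝ :=
  LinearMap.toContinuousLinearMap
    { toFun := fun q => q.re, map_add' := fun _ _ => by simp, map_smul' := fun _ _ => by simp }

lemma reL_apply (q : ℍ[ℝ]) : reL q = q.re := rfl

lemma re_chInner (u v : CH) : (chInner u v).re = inner ℝ u v := by
  simp [chInner, WithLp.prod_inner_apply, Quaternion.inner_def, Quaternion.re_mul]

lemma re_e (l : Fin 3) : (e l).re = 0 := by fin_cases l <;> rfl

lemma imI_e (l : Fin 3) : (e l).imI = if l = 0 then 1 else 0 := by fin_cases l <;> rfl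

lemma imJ_e (l : Fin 3) : (e l).imJ = if l = 1 then 1 else 0 := by fin_cases l <;> rfl

lemma imK_e (l : Fin 3) : (e l).imK = if l = 2 then 1 else 0 := by fin_cases l <;> rfl

lemma star_e (l : Fin 3) : star (e l) = - e l := by
  apply Quaternion.ext <;> simp [re_e]

lemma e_mul_self (l : Fin 3) : e l * e l = -1 := by
  apply Quaternion.ext <;> simp [re_e, imI_e, imJ_e, imK_e] <;> fin_cases l <;> simp

lemma e_anticomm {l j : Fin 3} (h : l ≠ j) : e l * e j = - (e j * e l) := by
  apply Quaternion.ext <;> simp [re_e, imI_e, imJ_e, imK_e] <;> grind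

lemma norm_mulL (q : ℍ[ℝ]) (u : CH) : ‖mulL q u‖ = ‖q‖ * ‖u‖ := by
  rw [← sq_eq_sq₀ (norm_nonneg _) (by positivity), mul_pow, WithLp.prod_norm_sq_eq_of_L2,
    WithLp.prod_norm_sq_eq_of_L2]
  simp [mulL]
  ring

lemma norm_e (l : Fin 3) : ‖e l‖ = 1 := by
  have h : ‖e l‖ * ‖e l‖ = 1 := by rw [← norm_mul, e_mul_self]; simp
  nlinarith [norm_nonneg (e l)]

lemma norm_mulI (u : CH) : ‖mulI u‖ = ‖u‖ := by
  rw [← sq_eq_sq₀ (norm_nonneg _) (norm_nonneg _), WithLp.prod_norm_sq_eq_of_L2,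
    WithLp.prod_norm_sq_eq_of_L2]
  simp [mulI]
  ring

lemma norm_iterate_mulI (n : ℕ) (u : CH) : ‖mulI^[n] u‖ = ‖u‖ := by
  induction n generalizing u with
  | zero => rfl
  | succ n ih => rw [Function.iterate_succ_apply, ih, norm_mulI]

/-- Testing with r = star (p - q) gives |p - q|² = 0. This lifts real variational identities to
quaternionic ones. -/
lemma ext_re_mul {p q : ℍ[ℝ]} (h : ∀ r : ℍ[ℝ], (p * r).re = (q * r).re) : p = q := by
  have h0 := h (star (p - q))
  have h1 : ((p - q) * star (p - q)).re = 0 := by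
    rw [sub_mul, Quaternion.re_sub, h0, sub_self]
  rw [← Quaternion.normSq_def] at h1
  exact sub_eq_zero.1 (Quaternion.normSq_eq_zero.1 h1)

end Algebra

/-! ### Operators on `L²` -/

section LTwo

variable {Ω : Set E3}

/-- The quaternionic scalar product of `L²` as a continuous real bilinear map. -/
def pairing (Ω : Set E3) : L2 Ω →L[ℝ] L2 Ω →L[ℝ] ℍ[ℝ] :=
  chInnerL.lpPairing (volume.restrict Ω) 2 2

lemma pairing_apply (f g : L2 Ω) : pairing Ω f g = ∫ x in Ω, chInner (f x) (g x) :=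
  chInnerL.lpPairing_eq_integral f g

lemma integrable_chInner (f g : L2 Ω) :
    Integrable (fun x => chInner (f x) (g x)) (volume.restrict Ω) :=
  memLp_one_iff_integrable.1 (chInnerL.memLp_of_bilin 1 (Lp.memLp f) (Lp.memLp g))

/-- The bridge to real Hilbert space theory, in which all estimates and the Lax–Milgram argument are
carried out. -/
lemma re_pairing (f g : L2 Ω) : (pairing Ω f g).re = inner ℝ f g := by
  rw [pairing_apply, ← reL_apply, ← reL.integral_comp_comm (integrable_chInner f g),
    L2.inner_def]
  simp only [reL_apply, re_chInner]

/-- Left multiplication by a quaternion on `L²`. -/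
def lmul (Ω : Set E3) (q : ℍ[ℝ]) : L2 Ω →L[ℝ] L2 Ω :=
  (mulLL q).compLpL 2 (volume.restrict Ω)

lemma coeFn_lmul (q : ℍ[ℝ]) (f : L2 Ω) :
    lmul Ω q f =ᵐ[volume.restrict Ω] fun x => mulL q (f x) :=
  (mulLL q).coeFn_compLpL f

/-- Right multiplication by a quaternion on `L²`. -/
def rmul (Ω : Set E3) (q : ℍ[ℝ]) : L2 Ω →L[ℝ] L2 Ω :=
  (mulRL q).compLpL 2 (volume.restrict Ω)

lemma coeFn_rmul (q : ℍ[ℝ]) (f : L2 Ω) :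
    rmul Ω q f =ᵐ[volume.restrict Ω] fun x => mulRL q (f x) :=
  (mulRL q).coeFn_compLpL f

lemma norm_lmul (q : ℍ[ℝ]) (f : L2 Ω) : ‖lmul Ω q f‖ ≤ ‖q‖ * ‖f‖ := by
  refine Lp.norm_le_mul_norm_of_ae_le_mul ?_
  filter_upwards [coeFn_lmul q f] with x hx
  rw [hx, norm_mulL]

open Classical in
/-- Multiplication by an essentially bounded function on `L²` (zero if `c` is not essentially
bounded). -/
def mulC (Ω : Set E3) (c : E3 → ℝ) : L2 Ω →L[ℝ] L2 Ω :=
  if h : MemLp c ⊤ (volume.restrict Ω) then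
    (ContinuousLinearMap.lsmul ℝ ℝ).holderL (volume.restrict Ω) ⊤ 2 2 (h.toLp c)
  else 0

lemma coeFn_mulC {c : E3 → ℝ} (h : MemLp c ⊤ (volume.restrict Ω)) (f : L2 Ω) :
    mulC Ω c f =ᵐ[volume.restrict Ω] fun x => c x • f x := by
  rw [mulC, dif_pos h]
  filter_upwards [(ContinuousLinearMap.lsmul ℝ ℝ).coeFn_holder (r := 2) (h.toLp c) f,
    h.coeFn_toLp] with x hx hc
  simp only [ContinuousLinearMap.holderL_apply_apply, hx, hc, ContinuousLinearMap.lsmul_apply]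

lemma norm_mulC_le (hΩ : IsOpen Ω) {c : E3 → ℝ} {C : ℝ} (h : MemLp c ⊤ (volume.restrict Ω))
    (hC : ∀ x ∈ Ω, |c x| ≤ C) (f : L2 Ω) : ‖mulC Ω c f‖ ≤ C * ‖f‖ := by
  refine Lp.norm_le_mul_norm_of_ae_le_mul ?_
  filter_upwards [coeFn_mulC h f, ae_restrict_mem hΩ.measurableSet] with x hx hxΩ
  rw [hx, norm_smul]
  exact mul_le_mul_of_nonneg_right (hC x hxΩ) (norm_nonneg _)

lemma pairing_rmul (f g : L2 Ω) (q : ℍ[ℝ]) :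
    pairing Ω f (rmul Ω q g) = pairing Ω f g * q := by
  have h : ∫ x in Ω, chInner (f x) (g x) * q = (∫ x in Ω, chInner (f x) (g x)) * q :=
    integral_mul_const_of_integrable (integrable_chInner f g)
  rw [pairing_apply, pairing_apply, ← h]
  refine integral_congr_ae ?_
  filter_upwards [coeFn_rmul q g] with x hx
  rw [hx, chInner_mulRL]

lemma rmul_lmul (p q : ℍ[ℝ]) (f : L2 Ω) : rmul Ω p (lmul Ω q f) = lmul Ω q (rmul Ω p f) := by
  refine Lp.ext ?_
  filter_upwards [coeFn_rmul p (lmul Ω q f), coeFn_lmul q f, coeFn_lmul q (rmul Ω p f),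
    coeFn_rmul p f] with x h1 h2 h3 h4
  rw [h1, h2, h3, h4, mulRL_mulL]

lemma rmul_mulC (p : ℍ[ℝ]) (c : E3 → ℝ) (f : L2 Ω) :
    rmul Ω p (mulC Ω c f) = mulC Ω c (rmul Ω p f) := by
  by_cases h : MemLp c ⊤ (volume.restrict Ω)
  · refine Lp.ext ?_
    filter_upwards [coeFn_rmul p (mulC Ω c f), coeFn_mulC h f, coeFn_mulC h (rmul Ω p f),
      coeFn_rmul p f] with x h1 h2 h3 h4
    rw [h1, h2, h3, h4, map_smul]
  · simp [mulC, h]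

lemma norm_sq_eq_integral (f : L2 Ω) : ‖f‖ ^ 2 = ∫ x in Ω, ‖f x‖ ^ 2 := by
  rw [← real_inner_self_eq_norm_sq, L2.inner_def]
  simp only [real_inner_self_eq_norm_sq]

end LTwo

/-! ### The Hilbert space `H^m_0` -/

section Sobolev

variable {m : ℕ} {Ω : Set E3}

/-- The multi-indices of order at most `m`. -/
def idx (m : ℕ) : Finset (Fin 3 → ℕ) :=
  (Fintype.piFinset fun _ => Finset.range (m + 1)).filter fun β => ∑ i, β i ≤ m

lemma mem_idx {β : Fin 3 → ℕ} : β ∈ idx m ↔ ∑ i, β i ≤ m := by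
  simp only [idx, Finset.mem_filter, Fintype.mem_piFinset, Finset.mem_range, and_iff_right_iff_imp]
  intro h i
  have := Finset.single_le_sum (f := β) (fun _ _ => Nat.zero_le _) (Finset.mem_univ i)
  omega

/-- Families of `L²` functions indexed by the multi-indices of order at most `m`. -/
abbrev Jet (m : ℕ) (Ω : Set E3) : Type := PiLp 2 fun _ : idx m => L2 Ω

/-- The families of derivatives of test functions. -/
def testJets (m : ℕ) (Ω : Set E3) : Submodule ℝ (Jet m Ω) where
  carrier := {U | ∃ φ : E3 → CH, IsTest Ω φ ∧ ∀ β, U β =ᵐ[volume.restrict Ω] mpd β.1 φ}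
  add_mem' := by
    rintro U V ⟨φ, hφ, hU⟩ ⟨ψ, hψ, hV⟩
    refine ⟨φ + ψ, hφ.add hψ, fun β => ?_⟩
    rw [mpd_add hφ.1 hψ.1]
    exact (Lp.coeFn_add _ _).trans ((hU β).add (hV β))
  zero_mem' := by
    refine ⟨0, isTest_zero, fun β => ?_⟩
    have h : mpd β.1 (0 : E3 → CH) = 0 := by
      have := mpd_clm_comp (0 : CH →L[ℝ] CH) (isTest_zero (Ω := Ω) (F := CH)).1 β.1
      simp only [zero_apply] at this
      exact this
    rw [h]
    exact Lp.coeFn_zero _ _ _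
  smul_mem' := by
    rintro c U ⟨φ, hφ, hU⟩
    refine ⟨fun x => (c • ContinuousLinearMap.id ℝ CH) (φ x), hφ.clm_comp _, fun β => ?_⟩
    rw [mpd_clm_comp _ hφ.1]
    exact (Lp.coeFn_smul _ _).trans ((hU β).const_smul c)

/-- `H^m_0`, realised as the closure of the families of derivatives of test functions. -/
def H0 (m : ℕ) (Ω : Set E3) : Submodule ℝ (Jet m Ω) := (testJets m Ω).topologicalClosure

instance : CompleteSpace (H0 m Ω) :=
  (Submodule.isClosed_topologicalClosure (testJets m Ω)).completeSpace_coe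

open Classical in
/-- The derivative `∂^β` on `H^m_0` (zero if the order of `β` exceeds `m`). -/
def der (β : Fin 3 → ℕ) : H0 m Ω →L[ℝ] L2 Ω :=
  if h : β ∈ idx m then (PiLp.proj 2 (fun _ : idx m => L2 Ω) ⟨β, h⟩).comp (H0 m Ω).subtypeL
  else 0

lemma der_apply {β : Fin 3 → ℕ} (h : β ∈ idx m) (U : H0 m Ω) :
    der β U = (U : Jet m Ω) ⟨β, h⟩ := by
  rw [der, dif_pos h]; rfl

/-- `U` is the family of derivatives of the test function `φ`. -/
def IsJetOf (U : H0 m Ω) (φ : E3 → CH) : Prop :=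
  IsTest Ω φ ∧ ∀ β ∈ idx m, der β U =ᵐ[volume.restrict Ω] mpd β φ

/-- Jets of test functions are dense, so closed conditions reduce to classical calculus. -/
lemma H0.induction {p : H0 m Ω → Prop} (hp : IsClosed {U | p U})
    (h : ∀ U φ, IsJetOf U φ → p U) (U : H0 m Ω) : p U := by
  have hd : Dense {U : H0 m Ω | (U : Jet m Ω) ∈ testJets m Ω} := by
    intro U
    rw [closure_subtype]
    have hU : (U : Jet m Ω) ∈ closure (testJets m Ω : Set (Jet m Ω)) := U.2
    refine closure_mono (fun V hV => ?_) hU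
    exact ⟨⟨V, subset_closure hV⟩, hV, rfl⟩
  refine hp.closure_subset_iff.2 (fun V hV => ?_) (hd U)
  obtain ⟨φ, hφ, hV⟩ := hV
  exact h V φ ⟨hφ, fun β hβ => by rw [der_apply hβ]; exact hV ⟨β, hβ⟩⟩

lemma IsTest.memLp {F : Type*} [NormedAddCommGroup F] [NormedSpace ℝ F] {φ : E3 → F}
    (h : IsTest Ω φ) (p : ENNReal) : MemLp φ p (volume.restrict Ω) :=
  (h.1.continuous.memLp_of_hasCompactSupport h.2.1).restrict Ω

lemma exists_isJetOf (m : ℕ) {φ : E3 → CH} (hφ : IsTest Ω φ) :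
    ∃ U : H0 m Ω, IsJetOf U φ := by
  have h := fun β => (hφ.mpd β).memLp 2
  refine ⟨⟨WithLp.toLp 2 fun β => (h β.1).toLp, subset_closure
    ⟨φ, hφ, fun β => (h β.1).coeFn_toLp⟩⟩, hφ, fun β hβ => ?_⟩
  rw [der_apply hβ]
  exact (h β).coeFn_toLp

lemma integral_bilin_mpd {φ : E3 → ℝ} {ψ : E3 → CH} (hφ : IsTest Ω φ) (hψ : IsTest Ω ψ)
    (β : Fin 3 → ℕ) :
    ∫ x in Ω, mpd β φ x • ψ x = (-1 : ℝ) ^ (∑ i, β i) • ∫ x in Ω, φ x • mpd β ψ x := by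
  let B : CH →L[ℝ] ℝ →L[ℝ] CH := (ContinuousLinearMap.lsmul ℝ ℝ).flip
  have e1 : ∀ {f : E3 → ℝ} {g : E3 → CH}, IsTest Ω f →
      ∫ x in Ω, f x • g x = ∫ x, B (g x) (f x) := fun hf => by
    rw [setIntegral_eq_integral_of_forall_compl_eq_zero (fun x hx => by simp [hf.eq_zero hx])]
    rfl
  have step : ∀ {f : E3 → ℝ} {g : E3 → CH}, IsTest Ω f → IsTest Ω g → ∀ l t,
      ∫ x, B (g x) ((pd l)^[t] f x) = (-1 : ℝ) ^ t • ∫ x, B ((pd l)^[t] g x) (f x) :=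
    fun hf hg l t => integral_bilin_iterate_pd B t hg.1 hg.2.1
      (hf.1.of_le (by exact_mod_cast le_top)) l
  rw [e1 (hφ.mpd β), e1 hφ]
  -- Moving the derivatives one direction at a time puts them on ψ in reverse order; these
  -- identities restore the order used by `mpd`.
  have c1 := iterate_pd_comm hψ.1 1 0 (β 1) (β 0)
  have c2 := iterate_pd_comm (contDiff_iterate_pd hψ.1 0 (β 0)) 2 1 (β 2) (β 1)
  have c3 := iterate_pd_comm hψ.1 2 0 (β 2) (β 0)
  unfold mpd
  rw [step ((hφ.iterate_pd 2 _).iterate_pd 1 _) hψ, step (hφ.iterate_pd 2 _) (hψ.iterate_pd 0 _),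
    step hφ ((hψ.iterate_pd 0 _).iterate_pd 1 _), smul_smul, smul_smul, ← pow_add, ← pow_add,
    Fin.sum_univ_three, c2, c3, iterate_pd_comm (contDiff_iterate_pd hψ.1 2 (β 2)) 1 0]

lemma isWeakDeriv_der {β : Fin 3 → ℕ} (hβ : β ∈ idx m) (U : H0 m Ω) :
    IsWeakDeriv Ω β (der 0 U) (der β U) := by
  intro φ hφ
  have h0 : (0 : Fin 3 → ℕ) ∈ idx m := mem_idx.2 (by simp)
  have hL : ∀ {ψ : E3 → ℝ} (hψ : IsTest Ω ψ) (w : L2 Ω), ∫ x in Ω, ψ x • w x =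
      (ContinuousLinearMap.lsmul ℝ ℝ).lpPairing (volume.restrict Ω) 2 2
        ((hψ.memLp 2).toLp) w := by
    intro ψ hψ w
    rw [ContinuousLinearMap.lpPairing_eq_integral]
    refine integral_congr_ae ?_
    filter_upwards [(hψ.memLp 2).coeFn_toLp] with x hx
    rw [hx]
    rfl
  induction U using H0.induction with
  | hp =>
    simp only [hL hφ, hL (hφ.mpd β)]
    exact isClosed_eq (by fun_prop) (by fun_prop)
  | h U ψ hU =>
    have e1 : ∫ x in Ω, mpd β φ x • (der 0 U : L2 Ω) x = ∫ x in Ω, mpd β φ x • ψ x :=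
      integral_congr_ae (by
        filter_upwards [hU.2 0 h0] with x hx
        rw [hx, mpd_zero])
    have e2 : ∫ x in Ω, φ x • (der β U : L2 Ω) x = ∫ x in Ω, φ x • mpd β ψ x :=
      integral_congr_ae (by
        filter_upwards [hU.2 β hβ] with x hx
        rw [hx])
    rw [e1, e2, integral_bilin_mpd hφ hU.1]

/-- The fundamental lemma of the calculus of variations, applied to w - w'. It makes the choice in
`weakDeriv` immaterial. -/
lemma IsWeakDeriv.unique (hΩ : IsOpen Ω) {β : Fin 3 → ℕ} {u w w' : L2 Ω}
    (h : IsWeakDeriv Ω β u w) (h' : IsWeakDeriv Ω β u w') : w = w' := by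
  have hloc : ∀ w : L2 Ω, LocallyIntegrableOn w Ω := fun w =>
    locallyIntegrableOn_of_locallyIntegrable_restrict
      ((Lp.memLp w).locallyIntegrable one_le_two)
  have hi : ∀ (w : L2 Ω) {φ : E3 → ℝ}, IsTest Ω φ →
      Integrable (fun x => φ x • w x) (volume.restrict Ω) := fun w φ hφ =>
    memLp_one_iff_integrable.1
      ((ContinuousLinearMap.lsmul ℝ ℝ).memLp_of_bilin 1 (hφ.memLp 2) (Lp.memLp w))
  have key := hΩ.ae_eq_zero_of_integral_contDiff_smul_eq_zero (μ := volume)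
    (f := fun x => w x - w' x) ((hloc w).sub (hloc w')) (fun φ h1 h2 h3 => by
      have hφ : IsTest Ω φ := ⟨h1, h2, h3⟩
      rw [← setIntegral_eq_integral_of_forall_compl_eq_zero (s := Ω)
        (fun x hx => by simp [hφ.eq_zero hx])]
      simp only [smul_sub]
      rw [integral_sub (hi w hφ) (hi w' hφ), sub_eq_zero]
      have := (h φ hφ).symm.trans (h' φ hφ)
      exact smul_right_injective CH (pow_ne_zero _ (by norm_num : (-1 : ℝ) ≠ 0)) this)
  refine Lp.ext ?_
  rw [Filter.EventuallyEq, ae_restrict_iff' hΩ.measurableSet]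
  filter_upwards [key] with x hx hxΩ
  exact sub_eq_zero.1 (hx hxΩ)

lemma IsWeakDeriv.weakDeriv_eq (hΩ : IsOpen Ω) {β : Fin 3 → ℕ} {u w : L2 Ω}
    (h : IsWeakDeriv Ω β u w) : weakDeriv Ω β u = w := by
  have hex : ∃ w, IsWeakDeriv Ω β u w := ⟨w, h⟩
  rw [weakDeriv, dif_pos hex]
  exact hex.choose_spec.unique hΩ h

lemma weakDeriv_der (hΩ : IsOpen Ω) {β : Fin 3 → ℕ} (hβ : β ∈ idx m) (U : H0 m Ω) :
    weakDeriv Ω β (der 0 U) = der β U :=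
  (isWeakDeriv_der hβ U).weakDeriv_eq hΩ

/-- With `exists_der_eq`, this shows that `der 0` maps the space of jets onto H^m_0. -/
lemma memH0_der (hΩ : IsOpen Ω) (U : H0 m Ω) : MemH0 m Ω (der 0 U) := by
  refine ⟨fun β hβ => ⟨_, isWeakDeriv_der (mem_idx.2 hβ) U⟩, ?_⟩
  obtain ⟨V, hV, hlim⟩ := mem_closure_iff_seq_limit.1
    (show (U : Jet m Ω) ∈ closure (testJets m Ω : Set (Jet m Ω)) from U.2)
  choose φ hφ hVφ using hV
  refine ⟨φ, hφ, fun β hβ => ?_⟩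
  have hβ' := mem_idx.2 hβ
  rw [weakDeriv_der hΩ hβ', der_apply hβ']
  have h1 : Tendsto (fun n => V n ⟨β, hβ'⟩) atTop (𝓝 ((U : Jet m Ω) ⟨β, hβ'⟩)) :=
    ((PiLp.proj (𝕜 := ℝ) 2 (fun _ : idx m => L2 Ω) ⟨β, hβ'⟩).continuous.tendsto _).comp hlim
  rw [Lp.tendsto_Lp_iff_tendsto_eLpNorm'] at h1
  refine h1.congr fun n => eLpNorm_congr_ae ?_
  filter_upwards [hVφ n ⟨β, hβ'⟩] with x hx
  simp [hx]

lemma exists_der_eq (hΩ : IsOpen Ω) {u : L2 Ω} (h : MemH0 m Ω u) :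
    ∃ U : H0 m Ω, der 0 U = u := by
  obtain ⟨-, φ, hφ, hlim⟩ := h
  choose V hV using fun n => exists_isJetOf m (hφ n)
  have hmem : (WithLp.toLp 2 fun β => weakDeriv Ω β.1 u : Jet m Ω) ∈ H0 m Ω := by
    have hcl : IsClosed (H0 m Ω : Set (Jet m Ω)) :=
      Submodule.isClosed_topologicalClosure (testJets m Ω)
    refine hcl.mem_of_tendsto (f := fun n => (V n : Jet m Ω)) (b := atTop) ?_
      (Eventually.of_forall fun n => (V n).2)
    refine ((PiLp.continuous_toLp 2 fun _ : idx m => L2 Ω).tendsto _).comp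
      (tendsto_pi_nhds.2 fun β => ?_) (f := fun n => WithLp.ofLp (V n : Jet m Ω))
    rw [Lp.tendsto_Lp_iff_tendsto_eLpNorm']
    refine (hlim β.1 (mem_idx.1 β.2)).congr fun n => eLpNorm_congr_ae ?_
    filter_upwards [(hV n).2 β.1 β.2] with x hx
    rw [der_apply β.2] at hx
    simp [hx]
  refine ⟨⟨_, hmem⟩, ?_⟩
  have h0 : (0 : Fin 3 → ℕ) ∈ idx m := mem_idx.2 (by simp)
  rw [der_apply h0]
  -- The component of order zero is `weakDeriv Ω 0 u`, which is u because u is its own weak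
  -- derivative of order zero.
  refine IsWeakDeriv.weakDeriv_eq hΩ fun φ _ => ?_
  simp [mpd_zero]

/-- Right multiplication by a quaternion preserves `H^m_0`. -/
lemma exists_rmul (q : ℍ[ℝ]) (U : H0 m Ω) :
    ∃ V : H0 m Ω, ∀ β ∈ idx m, der β V = rmul Ω q (der β U) := by
  let R : Jet m Ω → Jet m Ω := fun U => WithLp.toLp 2 fun β => rmul Ω q (U β)
  have hR : Continuous R := (PiLp.continuous_toLp 2 fun _ : idx m => L2 Ω).comp
    (continuous_pi fun β => (rmul Ω q).continuous.comp
      (PiLp.proj (𝕜 := ℝ) 2 (fun _ : idx m => L2 Ω) β).continuous)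
  have hRU : R U ∈ H0 m Ω := by
    refine map_mem_closure hR U.2 fun V hV => ?_
    obtain ⟨φ, hφ, hV⟩ := hV
    refine ⟨fun x => mulRL q (φ x), hφ.clm_comp _, fun β => ?_⟩
    rw [mpd_clm_comp _ hφ.1]
    filter_upwards [coeFn_rmul q (V β), hV β] with x h1 h2
    rw [← h2, ← h1]
  exact ⟨⟨R U, hRU⟩, fun β hβ => by rw [der_apply hβ, der_apply hβ]⟩

end Sobolev

/-! ### Leibniz identities for sequences -/

section Umbral

variable {E : Type*} [AddCommGroup E] [Module ℝ E]

/-- The linear map on polynomials in three variables that sends `X₀^i X₁^j X₂^k` to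
`f_i g_j ν_k`. -/
def umbral (f g : ℕ → ℝ) (ν : ℕ → E) : MvPolynomial (Fin 3) ℝ →ₗ[ℝ] E :=
  (MvPolynomial.basisMonomials (Fin 3) ℝ).constr ℝ fun d => (f (d 0) * g (d 1)) • ν (d 2)

lemma umbral_apply (f g : ℕ → ℝ) (ν : ℕ → E) (i j k : ℕ) :
    umbral f g ν (MvPolynomial.X 0 ^ i * MvPolynomial.X 1 ^ j * MvPolynomial.X 2 ^ k) =
      (f i * g j) • ν k := by
  have h : (MvPolynomial.X 0 ^ i * MvPolynomial.X 1 ^ j * MvPolynomial.X 2 ^ k :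
      MvPolynomial (Fin 3) ℝ) = MvPolynomial.basisMonomials (Fin 3) ℝ
        (Finsupp.single 0 i + Finsupp.single 1 j + Finsupp.single 2 k) := by
    simp [MvPolynomial.X_pow_eq_monomial, MvPolynomial.monomial_mul]
  rw [h, umbral, Module.Basis.constr_basis]
  simp

lemma sum_pow_eq_sum_antidiagonalTuple {R : Type*} [CommSemiring R] (x : Fin 3 → R) (n : ℕ) :
    (x 0 + x 1 + x 2) ^ n = ∑ t ∈ Finset.Nat.antidiagonalTuple 3 n,
      (Nat.multinomial Finset.univ t : R) * (x 0 ^ t 0 * x 1 ^ t 1 * x 2 ^ t 2) := by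
  rw [← Fin.sum_univ_three, Finset.sum_pow_eq_sum_piAntidiag]
  refine Finset.sum_congr ?_ fun t _ => by rw [Fin.prod_univ_three]
  ext t
  simp [Finset.Nat.mem_antidiagonalTuple]

/-- The image under `umbral` of (X₀ + X₁ + X₂)^m = ((X₀ + X₁) + X₂)^m. -/
lemma sum_multinomial_smul (f g : ℕ → ℝ) (ν : ℕ → E) (m : ℕ) :
    ∑ t ∈ Finset.Nat.antidiagonalTuple 3 m,
        (Nat.multinomial Finset.univ t : ℝ) • ((f (t 0) * g (t 1)) • ν (t 2)) =
      ∑ t ∈ Finset.HasAntidiagonal.antidiagonal m, (m.choose t.1 : ℝ) •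
        ((∑ r ∈ Finset.HasAntidiagonal.antidiagonal t.1,
          (t.1.choose r.1 : ℝ) * (f r.1 * g r.2)) • ν t.2) := by
  have h1 := congrArg (umbral f g ν)
    (sum_pow_eq_sum_antidiagonalTuple (MvPolynomial.X : Fin 3 → MvPolynomial (Fin 3) ℝ) m)
  have h2 : (MvPolynomial.X 0 + MvPolynomial.X 1 + MvPolynomial.X 2 :
      MvPolynomial (Fin 3) ℝ) ^ m = _ := (Commute.all _ _).add_pow' m
  simp only [(Commute.all (MvPolynomial.X 0 : MvPolynomial (Fin 3) ℝ) _).add_pow', Finset.sum_mul,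
    smul_mul_assoc] at h2
  rw [h2] at h1
  simp only [map_sum, ← nsmul_eq_mul, map_smul, umbral_apply, ← Nat.cast_smul_eq_nsmul ℝ] at h1
  rw [← h1]
  refine Finset.sum_congr rfl fun t _ => ?_
  rw [Finset.sum_smul]
  simp only [mul_smul]

/-- The image under `umbral` of (X₀ + X₂)^m = (-X₁ + (X₀ + X₁ + X₂))^m. As X₁ is absent on the left,
only g 0 survives there. -/
lemma sum_alternating_smul (f g : ℕ → ℝ) (ν : ℕ → E) (m : ℕ) :
    ∑ k ∈ Finset.range (m + 1), ∑ t ∈ Finset.Nat.antidiagonalTuple 3 (m - k),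
        ((-1 : ℝ) ^ k * (m.choose k : ℝ) * (Nat.multinomial Finset.univ t : ℝ)) •
          ((f (t 0) * g (t 1 + k)) • ν (t 2)) =
      ∑ t ∈ Finset.HasAntidiagonal.antidiagonal m,
        (m.choose t.1 : ℝ) • ((f t.1 * g 0) • ν t.2) := by
  let X : Fin 3 → MvPolynomial (Fin 3) ℝ := MvPolynomial.X
  have h1 : (X 0 + X 2) ^ m = ∑ k ∈ Finset.range (m + 1),
      (-X 1) ^ k * (X 0 + X 1 + X 2) ^ (m - k) * (m.choose k : MvPolynomial (Fin 3) ℝ) := by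
    rw [← add_pow]
    congr 1
    ring
  have h2 : ∀ k ∈ Finset.range (m + 1),
      (-X 1) ^ k * (X 0 + X 1 + X 2) ^ (m - k) * (m.choose k : MvPolynomial (Fin 3) ℝ) =
      ∑ t ∈ Finset.Nat.antidiagonalTuple 3 (m - k),
        ((-1 : ℝ) ^ k * (m.choose k : ℝ) * (Nat.multinomial Finset.univ t : ℝ)) •
          (X 0 ^ t 0 * X 1 ^ (t 1 + k) * X 2 ^ t 2) := by
    intro k _
    rw [sum_pow_eq_sum_antidiagonalTuple, Finset.mul_sum, Finset.sum_mul]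
    refine Finset.sum_congr rfl fun t _ => ?_
    rw [MvPolynomial.smul_eq_C_mul, neg_pow]
    simp only [map_mul, map_pow, map_neg, map_one, map_natCast]
    ring
  rw [Finset.sum_congr rfl h2, (Commute.all _ _).add_pow'] at h1
  have h3 := congrArg (umbral f g ν) h1
  have h4 : ∀ i k, umbral f g ν (X 0 ^ i * X 2 ^ k) = (f i * g 0) • ν k := fun i k => by
    rw [← umbral_apply]; simp [X]
  simp only [map_sum, map_smul, h4, X, umbral_apply,
    ← Nat.cast_smul_eq_nsmul ℝ] at h3
  exact h3.symm

end Umbral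

/-! ### Coefficients -/

section Coefficients

variable {m : ℕ} {Ω : Set E3} {A B : E3 → ℝ}

/-- `A` is of class `C^m` in `Ω`, and its pure derivatives of order at most `m` are bounded. -/
structure IsCoef (m : ℕ) (Ω : Set E3) (A : E3 → ℝ) : Prop where
  contDiffOn : ContDiffOn ℝ m A Ω
  bdd : ∀ (l : Fin 3) (t : ℕ), t ≤ m → ∃ C, ∀ x ∈ Ω, |(pd l)^[t] A x| ≤ C

lemma IsCmClosure.isCoef (hb : Bornology.IsBounded Ω) (h : IsCmClosure m Ω A) :
    IsCoef m Ω A := by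
  refine ⟨h.1, fun l t ht => ?_⟩
  obtain ⟨g, hg, heq⟩ := h.2 (Pi.single l t) (by simpa using ht)
  obtain ⟨C, hC⟩ := hb.isCompact_closure.exists_bound_of_continuousOn hg
  refine ⟨C, fun x hx => ?_⟩
  rw [← mpd_single, heq hx]
  exact hC x (subset_closure hx)

lemma IsCoef.memLp (hΩ : IsOpen Ω) (h : IsCoef m Ω A) (l : Fin 3) {t : ℕ} (ht : t ≤ m) :
    MemLp ((pd l)^[t] A) ⊤ (volume.restrict Ω) := by
  obtain ⟨C, hC⟩ := h.bdd l t ht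
  refine memLp_top_of_bound (ContinuousOn.aestronglyMeasurable ?_ hΩ.measurableSet) C ?_
  · exact (contDiffOn_iterate_pd hΩ l t (n := 0)
      (h.contDiffOn.of_le (by norm_cast; omega))).continuousOn
  · filter_upwards [ae_restrict_mem hΩ.measurableSet] with x hx
    exact hC x hx

lemma iterate_pd_mul (hΩ : IsOpen Ω) (l : Fin 3) (n : ℕ)
    (hA : ContDiffOn ℝ n A Ω) (hB : ContDiffOn ℝ n B Ω) {x : E3} (hx : x ∈ Ω) :
    (pd l)^[n] (fun y => A y * B y) x = ∑ t ∈ Finset.HasAntidiagonal.antidiagonal n,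
      (n.choose t.1 : ℝ) * ((pd l)^[t.1] A x * (pd l)^[t.2] B x) :=
  iterate_pd_smul hΩ l n hA hB hx

lemma IsCoef.mul (hΩ : IsOpen Ω) (hA : IsCoef m Ω A) (hB : IsCoef m Ω B) :
    IsCoef m Ω (fun y => A y * B y) := by
  refine ⟨hA.contDiffOn.mul hB.contDiffOn, fun l t ht => ?_⟩
  choose! C hC using fun t => hA.bdd l t
  choose! D hD using fun t => hB.bdd l t
  refine ⟨∑ r ∈ Finset.HasAntidiagonal.antidiagonal t, (t.choose r.1 : ℝ) * (C r.1 * D r.2),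
    fun x hx => ?_⟩
  rw [iterate_pd_mul hΩ l t (hA.contDiffOn.of_le (by exact_mod_cast ht))
    (hB.contDiffOn.of_le (by exact_mod_cast ht)) hx]
  refine (Finset.abs_sum_le_sum_abs _ _).trans (Finset.sum_le_sum fun r hr => ?_)
  have hr' := Finset.HasAntidiagonal.mem_antidiagonal.mp hr
  have h1 := hC r.1 (by omega) x hx
  have h2 := hD r.2 (by omega) x hx
  rw [abs_mul, abs_mul, Nat.abs_cast]
  gcongr
  exact (abs_nonneg _).trans h1

lemma iterate_pd_linear_comb (hΩ : IsOpen Ω) (l : Fin 3) (c d : ℝ) (n : ℕ)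
    (hA : ContDiffOn ℝ n A Ω) (hB : ContDiffOn ℝ n B Ω) {x : E3} (hx : x ∈ Ω) :
    (pd l)^[n] (fun y => c * A y + d * B y) x = c * (pd l)^[n] A x + d * (pd l)^[n] B x := by
  induction n generalizing x with
  | zero => rfl
  | succ n ih =>
    have ih' := fun (y : E3) (hy : y ∈ Ω) => ih (hA.of_le (by norm_cast; omega))
      (hB.of_le (by norm_cast; omega)) hy
    have hd : ∀ {f : E3 → ℝ}, ContDiffOn ℝ (n + 1 : ℕ) f Ω →
        DifferentiableAt ℝ ((pd l)^[n] f) x := fun hf =>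
      ((contDiffOn_iterate_pd hΩ l n (n := 1) (hf.of_le (by norm_cast; omega))).differentiableOn
        (by simp)).differentiableAt (hΩ.mem_nhds hx)
    rw [Function.iterate_succ_apply', pd_congr_eqOn hΩ (fun y hy => ih' y hy) l hx]
    have := (((hd hA).hasFDerivAt.const_mul c).add ((hd hB).hasFDerivAt.const_mul d)).fderiv
    rw [Function.iterate_succ_apply', Function.iterate_succ_apply']
    change fderiv ℝ ((fun y => c * (pd l)^[n] A y) + fun y => d * (pd l)^[n] B y) x _ = _
    rw [this]
    simp [pd]

lemma IsCoef.linear_comb (hΩ : IsOpen Ω) (hA : IsCoef m Ω A) (hB : IsCoef m Ω B) (c d : ℝ) :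
    IsCoef m Ω (fun y => c * A y + d * B y) := by
  refine ⟨(contDiffOn_const.mul hA.contDiffOn).add (contDiffOn_const.mul hB.contDiffOn),
    fun l t ht => ?_⟩
  obtain ⟨C, hC⟩ := hA.bdd l t ht
  obtain ⟨D, hD⟩ := hB.bdd l t ht
  refine ⟨|c| * C + |d| * D, fun x hx => ?_⟩
  rw [iterate_pd_linear_comb hΩ l c d t (hA.contDiffOn.of_le (by exact_mod_cast ht))
    (hB.contDiffOn.of_le (by exact_mod_cast ht)) hx]
  refine (abs_add_le _ _).trans ?_
  rw [abs_mul, abs_mul]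
  gcongr
  exacts [hC x hx, hD x hx]

end Coefficients

/-! ### The form `b_s` through the operator and its formal adjoint -/

section Form

variable {m : ℕ} {Ω : Set E3} {A : E3 → ℝ} {a : Fin 3 → E3 → ℝ}

lemma single_mem_idx {t : ℕ} (ht : t ≤ m) (l : Fin 3) : Pi.single l t ∈ idx m :=
  mem_idx.2 (by simpa using ht)

/-- `∂_l^t` on `H^m_0`. -/
def dpd (l : Fin 3) (t : ℕ) : H0 m Ω →L[ℝ] L2 Ω := der (Pi.single l t)

lemma wpd_der (hΩ : IsOpen Ω) (l : Fin 3) {t : ℕ} (ht : t ≤ m) (U : H0 m Ω) :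
    wpd Ω l t (der 0 U) = dpd l t U :=
  weakDeriv_der hΩ (single_mem_idx ht l) U

lemma IsJetOf.dpd_eq {U : H0 m Ω} {φ : E3 → CH} (h : IsJetOf U φ) (l : Fin 3) {t : ℕ}
    (ht : t ≤ m) : dpd l t U =ᵐ[volume.restrict Ω] (pd l)^[t] φ := by
  rw [← mpd_single]
  exact h.2 _ (single_mem_idx ht l)

lemma coeFn_sum_mulC {ι : Type*} (s : Finset ι) (r : ι → ℝ) {c : ι → E3 → ℝ}
    (hc : ∀ i ∈ s, MemLp (c i) ⊤ (volume.restrict Ω)) (w : ι → L2 Ω) :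
    (∑ i ∈ s, r i • mulC Ω (c i) (w i) : L2 Ω) =ᵐ[volume.restrict Ω]
      fun x => ∑ i ∈ s, r i • (c i x • w i x) := by
  have h : ∀ᵐ x ∂volume.restrict Ω, ∀ i ∈ s,
      (r i • mulC Ω (c i) (w i) : L2 Ω) x = r i • (c i x • w i x) := by
    rw [Filter.eventually_all_finset]
    intro i hi
    filter_upwards [Lp.coeFn_smul (r i) (mulC Ω (c i) (w i)), coeFn_mulC (hc i hi) (w i)]
      with x h1 h2
    rw [h1, Pi.smul_apply, h2]
  filter_upwards [h, Lp.coeFn_finsetSum s fun i => r i • mulC Ω (c i) (w i)] with x h1 h2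
  rw [h2, Finset.sum_apply]
  exact Finset.sum_congr rfl fun i hi => h1 i hi

/-- `u ↦ ∂_l^m (A u)`, expanded by the Leibniz rule. -/
def leib (m : ℕ) (Ω : Set E3) (A : E3 → ℝ) (l : Fin 3) : H0 m Ω →L[ℝ] L2 Ω :=
  ∑ t ∈ Finset.HasAntidiagonal.antidiagonal m,
    (m.choose t.1 : ℝ) • (mulC Ω ((pd l)^[t.1] A)).comp (dpd l t.2)

lemma leib_apply (l : Fin 3) (V : H0 m Ω) :
    leib m Ω A l V = ∑ t ∈ Finset.HasAntidiagonal.antidiagonal m,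
      (m.choose t.1 : ℝ) • mulC Ω ((pd l)^[t.1] A) (dpd l t.2 V) := by
  simp [leib]

lemma coeFn_leib (hΩ : IsOpen Ω) (hA : IsCoef m Ω A) (l : Fin 3) (V : H0 m Ω) :
    leib m Ω A l V =ᵐ[volume.restrict Ω] fun x => ∑ t ∈ Finset.HasAntidiagonal.antidiagonal m,
      (m.choose t.1 : ℝ) • ((pd l)^[t.1] A x • dpd l t.2 V x) := by
  rw [leib_apply]
  exact coeFn_sum_mulC _ (fun t : ℕ × ℕ => (m.choose t.1 : ℝ))
    (c := fun t => (pd l)^[t.1] A) (fun t ht => hA.memLp hΩ l (by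
      have := Finset.HasAntidiagonal.mem_antidiagonal.mp ht; omega))
    fun t => dpd l t.2 V

lemma pairing_mulC_left {c : E3 → ℝ} (hc : MemLp c ⊤ (volume.restrict Ω)) (q : ℍ[ℝ])
    (f g : L2 Ω) :
    pairing Ω (lmul Ω q (mulC Ω c f)) g = pairing Ω (lmul Ω q f) (mulC Ω c g) := by
  rw [pairing_apply, pairing_apply]
  refine integral_congr_ae ?_
  filter_upwards [coeFn_lmul q (mulC Ω c f), coeFn_lmul q f, coeFn_mulC hc f,
    coeFn_mulC hc g] with x h1 h2 h3 h4
  rw [h1, h2, h3, h4, ← chInnerL_apply, ← chInnerL_apply, ← mulLL_apply, ← mulLL_apply,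
    map_smul, map_smul, map_smul]
  rfl

lemma setIntegral_chInner_smul {c : E3 → ℝ} (hc : MemLp c ⊤ (volume.restrict Ω)) (q : ℍ[ℝ])
    (f g : L2 Ω) :
    ∫ x in Ω, chInner (c x • mulL q (f x)) (g x) = pairing Ω (lmul Ω q f) (mulC Ω c g) := by
  rw [pairing_apply]
  refine integral_congr_ae ?_
  filter_upwards [coeFn_lmul q f, coeFn_mulC hc g] with x h1 h2
  rw [h1, h2, ← chInnerL_apply, ← chInnerL_apply, map_smul, map_smul]
  rfl

lemma pairing_lmul_lmul (p q : ℍ[ℝ]) (f g : L2 Ω) :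
    pairing Ω (lmul Ω p f) (lmul Ω q g) = pairing Ω (lmul Ω (star q * p) f) g := by
  simp only [pairing_apply]
  refine integral_congr_ae ?_
  filter_upwards [coeFn_lmul p f, coeFn_lmul q g, coeFn_lmul (star q * p) f] with x h1 h2 h3
  rw [h1, h2, h3, chInner_mulL]

lemma lmul_one (f : L2 Ω) : lmul Ω 1 f = f := by
  refine Lp.ext ?_
  filter_upwards [coeFn_lmul 1 f] with x h1
  rw [h1, mulL_one]

lemma lmul_neg (q : ℍ[ℝ]) (f : L2 Ω) : lmul Ω (-q) f = - lmul Ω q f := by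
  refine Lp.ext ?_
  filter_upwards [coeFn_lmul (-q) f, coeFn_lmul q f, Lp.coeFn_neg (lmul Ω q f)] with x h1 h2 h3
  rw [h1, h3, Pi.neg_apply, h2, mulL_neg]

/-- Integration by parts: both sides are `⟨q ∂_l^m u, ∂_j^m (A v)⟩`. -/
lemma pairing_leib_swap (hΩ : IsOpen Ω) (hA : IsCoef m Ω A) (q : ℍ[ℝ]) (l j : Fin 3)
    (U V : H0 m Ω) :
    pairing Ω (lmul Ω q (dpd l m U)) (leib m Ω A j V) =
      pairing Ω (lmul Ω q (dpd j m U)) (leib m Ω A l V) := by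
  induction U using H0.induction with
  | hp => exact isClosed_eq (by fun_prop) (by fun_prop)
  | h U φ hU =>
  induction V using H0.induction with
  | hp => exact isClosed_eq (by fun_prop) (by fun_prop)
  | h V ψ hV =>
  have key : ∀ l j : Fin 3, pairing Ω (lmul Ω q (dpd l m U)) (leib m Ω A j V) =
      ∫ x in Ω, (chInnerL.comp (mulLL q)) ((pd l)^[m] φ x)
        (∑ t ∈ Finset.HasAntidiagonal.antidiagonal m,
          (m.choose t.1 : ℝ) • ((pd j)^[t.1] A x • (pd j)^[t.2] ψ x)) := by
    intro l j
    rw [pairing_apply]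
    have h : ∀ᵐ x ∂volume.restrict Ω, ∀ t ∈ Finset.HasAntidiagonal.antidiagonal m,
        dpd j t.2 V x = (pd j)^[t.2] ψ x := by
      rw [Filter.eventually_all_finset]
      intro t ht
      exact hV.dpd_eq j (by have := Finset.HasAntidiagonal.mem_antidiagonal.mp ht; omega)
    refine integral_congr_ae ?_
    filter_upwards [coeFn_lmul q (dpd l m U), coeFn_leib hΩ hA j V, hU.dpd_eq l le_rfl, h]
      with x h1 h2 h3 h4
    rw [h1, h2, h3, Finset.sum_congr rfl fun t ht => by rw [h4 t ht]]
    rfl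
  rw [key, key]
  exact setIntegral_leibniz_swap hΩ _ m hA.contDiffOn hU.1 hV.1 l j

/-- At each point this is `sum_alternating_smul`: its k = 0 part is the expansion of ∂_l^m(f g v),
and the parts k ≥ 1 are the coefficients in `lowerTerms`. -/
lemma sum_mulC_add_leib (hΩ : IsOpen Ω) {f g : E3 → ℝ} (hf : IsCoef m Ω f) (hg : IsCoef m Ω g)
    (l : Fin 3) (V : H0 m Ω) :
    (∑ p ∈ (Finset.Icc 1 m).sigma fun k => Finset.Nat.antidiagonalTuple 3 (m - k),
        ((-1 : ℝ) ^ p.1 * (m.choose p.1 : ℝ) * (Nat.multinomial Finset.univ p.2 : ℝ)) •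
          mulC Ω (fun x => (pd l)^[p.2 0] f x * (pd l)^[p.2 1 + p.1] g x) (dpd l (p.2 2) V)) +
      leib m Ω (fun y => f y * g y) l V = mulC Ω g (leib m Ω f l V) := by
  have hmem : ∀ p ∈ (Finset.Icc 1 m).sigma fun k => Finset.Nat.antidiagonalTuple 3 (m - k),
      MemLp (fun x => (pd l)^[p.2 0] f x * (pd l)^[p.2 1 + p.1] g x) ⊤ (volume.restrict Ω) := by
    intro p hp
    rw [Finset.mem_sigma, Finset.mem_Icc, Finset.Nat.mem_antidiagonalTuple,
      Fin.sum_univ_three] at hp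
    exact MemLp.mul (p := ⊤) (q := ⊤) (r := ⊤) (hg.memLp hΩ l (by omega)) (hf.memLp hΩ l (by omega))
  refine Lp.ext ?_
  filter_upwards [Lp.coeFn_add (∑ p ∈ (Finset.Icc 1 m).sigma
        fun k => Finset.Nat.antidiagonalTuple 3 (m - k),
        ((-1 : ℝ) ^ p.1 * (m.choose p.1 : ℝ) * (Nat.multinomial Finset.univ p.2 : ℝ)) •
          mulC Ω (fun x => (pd l)^[p.2 0] f x * (pd l)^[p.2 1 + p.1] g x) (dpd l (p.2 2) V))
      (leib m Ω (fun y => f y * g y) l V),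
    coeFn_sum_mulC _ _ hmem (fun p => dpd l (p.2 2) V), coeFn_leib hΩ (hf.mul hΩ hg) l V,
    coeFn_leib hΩ hf l V, coeFn_mulC (hg.memLp hΩ l (Nat.zero_le m)) (leib m Ω f l V),
    ae_restrict_mem hΩ.measurableSet] with x h1 h2 h3 h4 h5 hx
  rw [Function.iterate_zero, id] at h5
  rw [h1, Pi.add_apply, h2, h3, h5, h4]
  have hA := sum_alternating_smul (fun t => (pd l)^[t] f x) (fun t => (pd l)^[t] g x)
    (fun t => dpd l t V x) m
  have hB := sum_multinomial_smul (fun t => (pd l)^[t] f x) (fun t => (pd l)^[t] g x)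
    (fun t => dpd l t V x) m
  rw [Finset.range_eq_Ico, Finset.sum_eq_sum_Ico_succ_bot (Nat.succ_pos m)] at hA
  simp only [pow_zero, Nat.choose_zero_right, Nat.cast_one, one_mul, Nat.sub_zero, add_zero] at hA
  rw [hB] at hA
  rw [Finset.sum_sigma, Finset.smul_sum]
  have hL : ∑ t ∈ Finset.HasAntidiagonal.antidiagonal m,
      (m.choose t.1 : ℝ) • ((pd l)^[t.1] (fun y => f y * g y) x • dpd l t.2 V x) =
      ∑ t ∈ Finset.HasAntidiagonal.antidiagonal m, (m.choose t.1 : ℝ) •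
        ((∑ r ∈ Finset.HasAntidiagonal.antidiagonal t.1,
          (t.1.choose r.1 : ℝ) * ((pd l)^[r.1] f x * (pd l)^[r.2] g x)) • dpd l t.2 V x) := by
    refine Finset.sum_congr rfl fun t ht => ?_
    have ht' := Finset.HasAntidiagonal.mem_antidiagonal.mp ht
    rw [iterate_pd_mul hΩ l t.1 (hf.contDiffOn.of_le (by norm_cast; omega))
      (hg.contDiffOn.of_le (by norm_cast; omega)) hx]
  rw [hL, add_comm]
  refine Eq.trans ?_ (hA.trans (Finset.sum_congr rfl fun t _ => ?_))
  · rfl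
  · simp only [Function.iterate_zero, id]
    rw [smul_comm (g x), smul_smul (g x), mul_comm (g x)]

lemma lowerTerms_add (hΩ : IsOpen Ω) {f g : E3 → ℝ} (hf : IsCoef m Ω f) (hg : IsCoef m Ω g)
    (q : ℍ[ℝ]) (l j : Fin 3) (U V : H0 m Ω) :
    lowerTerms m Ω q l j f g (der 0 U) (der 0 V) +
        pairing Ω (lmul Ω q (dpd j m U)) (leib m Ω (fun y => f y * g y) l V) =
      pairing Ω (lmul Ω q (dpd j m U)) (mulC Ω g (leib m Ω f l V)) := by
  rw [← sum_mulC_add_leib hΩ hf hg l V, map_add, map_sum, Finset.sum_sigma, lowerTerms]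
  congr 1
  refine Finset.sum_congr rfl fun k hk => Finset.sum_congr rfl fun t ht => ?_
  rw [Finset.mem_Icc] at hk
  rw [Finset.Nat.mem_antidiagonalTuple, Fin.sum_univ_three] at ht
  have hmem : MemLp (fun x => (pd l)^[t 0] f x * (pd l)^[t 1 + k] g x) ⊤ (volume.restrict Ω) :=
    MemLp.mul (p := ⊤) (q := ⊤) (r := ⊤) (hg.memLp hΩ l (by omega)) (hf.memLp hΩ l (by omega))
  rw [wpd_der hΩ j le_rfl, wpd_der hΩ l (by omega), map_smul, ← setIntegral_chInner_smul hmem]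

/-- `T` up to the factor `i^(m-1)`. -/
def opS (m : ℕ) (Ω : Set E3) (a : Fin 3 → E3 → ℝ) : H0 m Ω →L[ℝ] L2 Ω :=
  ∑ j, (lmul Ω (e j)).comp ((mulC Ω (a j)).comp (dpd j m))

/-- The formal adjoint of `T` up to the factor `i^(m-1)`. -/
def adjS (m : ℕ) (Ω : Set E3) (a : Fin 3 → E3 → ℝ) : H0 m Ω →L[ℝ] L2 Ω :=
  ∑ l, (lmul Ω (e l)).comp (leib m Ω (a l) l)

lemma opS_apply (U : H0 m Ω) : opS m Ω a U = ∑ j, lmul Ω (e j) (mulC Ω (a j) (dpd j m U)) := by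
  simp [opS]

lemma adjS_apply (V : H0 m Ω) : adjS m Ω a V = ∑ l, lmul Ω (e l) (leib m Ω (a l) l V) := by
  simp [adjS]

lemma IsCoef.memLp_self (hΩ : IsOpen Ω) (h : IsCoef m Ω A) : MemLp A ⊤ (volume.restrict Ω) :=
  h.memLp hΩ 0 (Nat.zero_le m)

lemma pairing_opS_adjS (hΩ : IsOpen Ω) (ha : ∀ l, IsCoef m Ω (a l)) (U V : H0 m Ω) :
    pairing Ω (opS m Ω a U) (adjS m Ω a V) = ∑ l, ∑ j,
      pairing Ω (lmul Ω (-(e l * e j)) (dpd j m U)) (mulC Ω (a j) (leib m Ω (a l) l V)) := by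
  rw [opS_apply, adjS_apply, map_sum]
  refine Finset.sum_congr rfl fun l _ => ?_
  rw [map_sum, sum_apply]
  refine Finset.sum_congr rfl fun j _ => ?_
  rw [pairing_lmul_lmul, pairing_mulC_left ((ha j).memLp_self hΩ), star_e, neg_mul]

lemma principal_terms (hΩ : IsOpen Ω) (hm : 1 ≤ m) (hA : IsCoef m Ω A) (l : Fin 3)
    (U V : H0 m Ω) :
    (∫ x in Ω, chInner (A x ^ 2 • wpd Ω l m (der 0 U) x) (wpd Ω l m (der 0 V) x)) +
      ∑ t ∈ (Finset.HasAntidiagonal.antidiagonal m).filter (fun t => t.2 ≤ m - 1),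
        (m.choose t.1 : ℝ) •
          (∫ x in Ω, chInner ((pd l)^[t.1] (fun y => A y ^ 2) x • wpd Ω l m (der 0 U) x)
            (wpd Ω l t.2 (der 0 V) x)) =
      pairing Ω (lmul Ω 1 (dpd l m U)) (leib m Ω (fun y => A y * A y) l V) := by
  have hAA := hA.mul hΩ hA
  have hterm : ∀ t : ℕ × ℕ, t.1 + t.2 = m →
      ∫ x in Ω, chInner ((pd l)^[t.1] (fun y => A y ^ 2) x • wpd Ω l m (der 0 U) x)
        (wpd Ω l t.2 (der 0 V) x) = pairing Ω (lmul Ω 1 (dpd l m U))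
          (mulC Ω ((pd l)^[t.1] fun y => A y * A y) (dpd l t.2 V)) := by
    intro t ht
    rw [← setIntegral_chInner_smul (hAA.memLp hΩ l (by omega)), wpd_der hΩ l le_rfl,
      wpd_der hΩ l (by omega)]
    simp only [mulL_one, pow_two]
  -- The condition on `t.2` omits exactly the principal term. This needs m ≥ 1, as the subtraction
  -- is truncated.
  have h0 : (Finset.HasAntidiagonal.antidiagonal m).filter (fun t => ¬ t.2 ≤ m - 1) = {(0, m)} := by
    ext ⟨i, k⟩
    simp only [Finset.mem_filter, Finset.HasAntidiagonal.mem_antidiagonal, Finset.mem_singleton,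
      Prod.mk.injEq]
    omega
  rw [leib_apply, map_sum, ← Finset.sum_filter_add_sum_filter_not
    (Finset.HasAntidiagonal.antidiagonal m) (fun t => t.2 ≤ m - 1), h0,
    Finset.sum_singleton, add_comm]
  congr 1
  · refine Finset.sum_congr rfl fun t ht => ?_
    rw [map_smul, hterm t (Finset.HasAntidiagonal.mem_antidiagonal.mp (Finset.mem_filter.1 ht).1)]
  · have := hterm (0, m) (by simp)
    simpa using this

/-- The algebra behind `bForm_eq`. On the diagonal P₁ + P₂ supplies the G that completes L to T, and
e_l² = -1 fixes the sign. For l < j the two copies of G cancel by symmetry, and e_l e_j = -e_j e_l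
matches the signs of T. -/
lemma sum_principal_add_lower {P₁ P₂ : Fin 3 → ℍ[ℝ]} {L G T : ℍ[ℝ] → Fin 3 → Fin 3 → ℍ[ℝ]}
    (S : ℍ[ℝ]) (hP : ∀ l, P₁ l + P₂ l = G 1 l l) (hL : ∀ q l j, L q l j + G q l j = T q l j)
    (hG : ∀ l j, G (e l * e j) l j = G (e l * e j) j l) (hT : ∀ q l j, T (-q) l j = - T q l j) :
    ∑ l, P₁ l + S + ∑ l, P₂ l + ∑ l, L 1 l l -
        ∑ p ∈ (Finset.univ : Finset (Fin 3 × Fin 3)).filter (fun p => p.1 < p.2),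
          (L (e p.1 * e p.2) p.1 p.2 - L (e p.1 * e p.2) p.2 p.1) =
      S + ∑ l, ∑ j, T (-(e l * e j)) l j := by
  have hfil : (Finset.univ : Finset (Fin 3 × Fin 3)).filter (fun p => p.1 < p.2) =
      {(0, 1), (0, 2), (1, 2)} := by decide
  have hanti : ∀ l j : Fin 3, l ≠ j → T (-(e l * e j)) l j = T (e j * e l) l j := fun l j h => by
    rw [e_anticomm h, neg_neg]
  have hd : ∀ l, T (-(e l * e l)) l l = T 1 l l := fun l => by rw [e_mul_self, neg_neg]
  rw [hfil, Finset.sum_insert (by decide), Finset.sum_insert (by decide), Finset.sum_singleton]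
  simp only [Fin.sum_univ_three, hd]
  rw [hanti 1 0 (by decide), hanti 2 0 (by decide), hanti 2 1 (by decide), hT (e 0 * e 1),
    hT (e 0 * e 2), hT (e 1 * e 2)]
  simp only [← hL, hG 0 1, hG 0 2, hG 1 2, ← hP]
  abel

/-- One factor of T² is moved onto v as its formal adjoint. The first-order term vanishes because Re
s = 0. -/
theorem bForm_eq (hΩ : IsOpen Ω) (hm : 1 ≤ m) (ha : ∀ l, IsCoef m Ω (a l)) {s : ℍ[ℝ]}
    (hs : s.re = 0) (U V : H0 m Ω) :
    bForm m Ω a s (der 0 U) (der 0 V) = ‖s‖ ^ 2 • pairing Ω (der 0 U) (der 0 V) +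
      pairing Ω (opS m Ω a U) (adjS m Ω a V) := by
  rw [pairing_opS_adjS hΩ ha, bForm, hs, l2Inner, ← pairing_apply, mul_zero, zero_smul, sub_zero]
  refine sum_principal_add_lower
    (L := fun q l j => lowerTerms m Ω q l j (a l) (a j) (der 0 U) (der 0 V))
    (G := fun q l j => pairing Ω (lmul Ω q (dpd j m U)) (leib m Ω (fun y => a l y * a j y) l V))
    (T := fun q l j => pairing Ω (lmul Ω q (dpd j m U)) (mulC Ω (a j) (leib m Ω (a l) l V)))
    _ (fun l => principal_terms hΩ hm (ha l) l U V)
    (fun q l j => lowerTerms_add hΩ (ha l) (ha j) q l j U V) (fun l j => ?_) (fun q l j => ?_)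
  · simp only [mul_comm (a j _)]
    exact (pairing_leib_swap hΩ ((ha l).mul hΩ (ha j)) _ l j U V).symm
  · rw [lmul_neg, map_neg, neg_apply]

end Form

/-! ### Estimates -/

section Estimates

variable {m : ℕ} {Ω : Set E3} {A : E3 → ℝ} {a : Fin 3 → E3 → ℝ}

/-- The seminorm `(∑_l ‖∂_l^m u‖²)^(1/2)`. -/
def topNorm (U : H0 m Ω) : ℝ := √(∑ l, ‖dpd l m U‖ ^ 2)

lemma topNorm_nonneg (U : H0 m Ω) : 0 ≤ topNorm U := Real.sqrt_nonneg _

lemma sq_topNorm (U : H0 m Ω) : topNorm U ^ 2 = ∑ l, ‖dpd l m U‖ ^ 2 :=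
  Real.sq_sqrt (Finset.sum_nonneg fun _ _ => sq_nonneg _)

lemma norm_dpd_le (l : Fin 3) (U : H0 m Ω) : ‖dpd l m U‖ ≤ topNorm U := by
  refine Real.le_sqrt_of_sq_le ?_
  exact Finset.single_le_sum (f := fun l => ‖dpd l m U‖ ^ 2) (fun _ _ => sq_nonneg _)
    (Finset.mem_univ l)

lemma continuous_topNorm : Continuous (topNorm : H0 m Ω → ℝ) := by
  unfold topNorm
  fun_prop

lemma norm_sq_der_le (hb : Bornology.IsBounded Ω) {k : ℕ} {β : Fin 3 → ℕ}
    (hβ : ∑ i, β i + k = m) (U : H0 m Ω) :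
    ‖der β U‖ ^ 2 ≤ (3 * poincareConst Ω ^ 2) ^ k * topNorm U ^ 2 := by
  induction U using H0.induction with
  | hp =>
    have := continuous_topNorm (m := m) (Ω := Ω)
    exact isClosed_le (by fun_prop) (by fun_prop)
  | h U φ hU =>
    have hn : ∀ γ ∈ idx m, ‖der γ U‖ ^ 2 = ∫ x in Ω, ‖mpd γ φ x‖ ^ 2 := fun γ hγ => by
      rw [norm_sq_eq_integral]
      refine integral_congr_ae ?_
      filter_upwards [hU.2 γ hγ] with x hx
      rw [hx]
    rw [sq_topNorm, hn β (mem_idx.2 (by omega))]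
    refine (setIntegral_norm_sq_mpd_le hb hU.1 k hβ).trans_eq ?_
    congr 1
    exact Finset.sum_congr rfl fun l _ => (hn _ (single_mem_idx le_rfl l)).symm

/-- `max(C_Ω, C_Ω^m)`. -/
def poincareMax (m : ℕ) (Ω : Set E3) : ℝ := max (poincareConst Ω) (poincareConst Ω ^ m)

lemma poincareMax_nonneg : 0 ≤ poincareMax m Ω :=
  poincareConst_nonneg.trans (le_max_left _ _)

/-- Powers of C_Ω are monotone in k, so an endpoint dominates: k = 1 if C_Ω ≤ 1, and k = m
otherwise. -/
lemma poincareConst_pow_le {k : ℕ} (hk : 1 ≤ k) (hkm : k ≤ m) :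
    poincareConst Ω ^ k ≤ poincareMax m Ω := by
  have h0 := poincareConst_nonneg (Ω := Ω)
  rcases le_total (poincareConst Ω) 1 with h | h
  · refine le_trans ?_ (le_max_left _ _)
    simpa using pow_le_pow_of_le_one h0 h hk
  · exact (pow_le_pow_right₀ h hkm).trans (le_max_right _ _)

lemma norm_dpd_lower_le (hb : Bornology.IsBounded Ω) {t : ℕ} (ht : t < m) (l : Fin 3)
    (U : H0 m Ω) : ‖dpd l t U‖ ≤ 2 ^ m * poincareMax m Ω * topNorm U := by
  have h0 := poincareConst_nonneg (Ω := Ω)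
  have h1 := poincareMax_nonneg (Ω := Ω) (m := m)
  have h2 := topNorm_nonneg U
  refine abs_le_of_sq_le_sq' ?_ (by positivity) |>.2
  refine (norm_sq_der_le hb (k := m - t) (by simp; omega) U).trans ?_
  rw [mul_pow _ (topNorm U)]
  gcongr
  calc (3 * poincareConst Ω ^ 2) ^ (m - t)
      -- The bound 3 ≤ 2² avoids a square root of 3 in the constant.
      ≤ (2 ^ 2 * poincareConst Ω ^ 2) ^ (m - t) := by gcongr; norm_num
    _ = (2 ^ (m - t) * poincareConst Ω ^ (m - t)) ^ 2 := by
        rw [← mul_pow, ← mul_pow, ← pow_mul, ← pow_mul, mul_comm 2 (m - t)]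
    _ ≤ (2 ^ m * poincareMax m Ω) ^ 2 := by
        gcongr
        · norm_num
        · omega
        · exact poincareConst_pow_le (by omega) (by omega)

/-- The term with no derivative on A cancels; every other term has a derivative of order below m on
u. The constant 4^m is 2^m from the binomials times 2^m from `norm_dpd_lower_le`. -/
lemma norm_leib_sub_le (hΩ : IsOpen Ω) (hb : Bornology.IsBounded Ω) (hA : IsCoef m Ω A)
    {D : ℝ} (hD0 : 0 ≤ D) (l : Fin 3)
    (hD : ∀ t, 1 ≤ t → t ≤ m → ∀ x ∈ Ω, |(pd l)^[t] A x| ≤ D) (U : H0 m Ω) :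
    ‖leib m Ω A l U - mulC Ω A (dpd l m U)‖ ≤ 4 ^ m * (D * poincareMax m Ω) * topNorm U := by
  have h1 := poincareMax_nonneg (Ω := Ω) (m := m)
  have h2 := topNorm_nonneg U
  have hmem : ((0, m) : ℕ × ℕ) ∈ Finset.HasAntidiagonal.antidiagonal m := by simp
  have hsum : ∑ t ∈ Finset.HasAntidiagonal.antidiagonal m, (m.choose t.1 : ℝ) = 2 ^ m := by
    have := Finset.Nat.sum_antidiagonal_eq_sum_range_succ (fun i _ => (m.choose i : ℝ)) m
    rw [this]
    exact_mod_cast Nat.sum_range_choose m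
  have hle : ‖leib m Ω A l U - mulC Ω A (dpd l m U)‖ ≤
      ∑ t ∈ (Finset.HasAntidiagonal.antidiagonal m).erase (0, m),
        (m.choose t.1 : ℝ) * (D * (2 ^ m * poincareMax m Ω * topNorm U)) := by
    rw [leib_apply, ← Finset.add_sum_erase _ _ hmem]
    simp only [Nat.choose_zero_right, Nat.cast_one, one_smul, Function.iterate_zero, id,
      add_sub_cancel_left]
    refine (norm_sum_le _ _).trans (Finset.sum_le_sum fun t ht => ?_)
    obtain ⟨hne, ht⟩ := Finset.mem_erase.1 ht
    have ht' := Finset.HasAntidiagonal.mem_antidiagonal.mp ht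
    have ht1 : 1 ≤ t.1 := by
      by_contra h
      exact hne (Prod.ext (by simp; omega) (by simp; omega))
    rw [norm_smul, Real.norm_natCast]
    gcongr
    refine (norm_mulC_le hΩ (hA.memLp hΩ l (by omega)) (hD t.1 ht1 (by omega)) _).trans ?_
    gcongr
    exact norm_dpd_lower_le hb (by omega) l U
  refine hle.trans ?_
  rw [← Finset.sum_mul]
  calc (∑ t ∈ (Finset.HasAntidiagonal.antidiagonal m).erase (0, m), (m.choose t.1 : ℝ)) *
        (D * (2 ^ m * poincareMax m Ω * topNorm U))
      ≤ 2 ^ m * (D * (2 ^ m * poincareMax m Ω * topNorm U)) := by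
        gcongr
        rw [← hsum]
        exact Finset.sum_le_sum_of_subset_of_nonneg (Finset.erase_subset _ _)
          fun _ _ _ => Nat.cast_nonneg _
    _ = 4 ^ m * (D * poincareMax m Ω) * topNorm U := by
        rw [show (4 : ℝ) = 2 * 2 by norm_num, mul_pow]
        ring

lemma norm_adjS_sub_opS_le (hΩ : IsOpen Ω) (hb : Bornology.IsBounded Ω)
    (ha : ∀ l, IsCoef m Ω (a l)) {D : ℝ} (hD0 : 0 ≤ D)
    (hD : ∀ t, 1 ≤ t → t ≤ m → ∀ j l, ∀ x ∈ Ω, |(pd j)^[t] (a l) x| ≤ D) (U : H0 m Ω) :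
    ‖adjS m Ω a U - opS m Ω a U‖ ≤ 3 * (4 ^ m * (D * poincareMax m Ω)) * topNorm U := by
  rw [adjS_apply, opS_apply, ← Finset.sum_sub_distrib]
  refine (norm_sum_le _ _).trans ?_
  have : ∀ l ∈ Finset.univ, ‖lmul Ω (e l) (leib m Ω (a l) l U) -
      lmul Ω (e l) (mulC Ω (a l) (dpd l m U))‖ ≤
        4 ^ m * (D * poincareMax m Ω) * topNorm U := by
    intro l _
    rw [← map_sub]
    refine (norm_lmul _ _).trans ?_
    rw [norm_e, one_mul]
    exact norm_leib_sub_le hΩ hb (ha l) hD0 l (fun t h1 h2 => hD t h1 h2 l l) U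
  refine (Finset.sum_le_card_nsmul _ _ _ this).trans_eq ?_
  simp
  ring

/-! ### Ellipticity of `T` -/

lemma inner_mulC_left {c : E3 → ℝ} (hc : MemLp c ⊤ (volume.restrict Ω)) (f g : L2 Ω) :
    inner ℝ (mulC Ω c f) g = inner ℝ f (mulC Ω c g) := by
  have := congrArg (·.re) (pairing_mulC_left hc 1 f g)
  simpa only [lmul_one, re_pairing] using this

lemma inner_lmul_lmul (p q : ℍ[ℝ]) (f g : L2 Ω) :
    inner ℝ (lmul Ω p f) (lmul Ω q g) = inner ℝ (lmul Ω (star q * p) f) g := by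
  rw [← re_pairing, pairing_lmul_lmul, re_pairing]

lemma le_inner_mulC (hΩ : IsOpen Ω) {c : E3 → ℝ} (hc : MemLp c ⊤ (volume.restrict Ω)) {γ : ℝ}
    (hγ : ∀ x ∈ Ω, γ ≤ c x) (f : L2 Ω) : γ * ‖f‖ ^ 2 ≤ inner ℝ (mulC Ω c f) f := by
  rw [← real_inner_self_eq_norm_sq, ← real_inner_smul_left, L2.inner_def, L2.inner_def]
  refine integral_mono_ae (L2.integrable_inner _ _) (L2.integrable_inner _ _) ?_
  filter_upwards [coeFn_mulC hc f, Lp.coeFn_smul γ f, ae_restrict_mem hΩ.measurableSet]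
    with x h1 h2 hx
  rw [h1, h2, Pi.smul_apply, real_inner_smul_left, real_inner_smul_left]
  exact mul_le_mul_of_nonneg_right (hγ x hx) real_inner_self_nonneg

lemma lmul_mulC (q : ℍ[ℝ]) {c : E3 → ℝ} (hc : MemLp c ⊤ (volume.restrict Ω)) (f : L2 Ω) :
    lmul Ω q (mulC Ω c f) = mulC Ω c (lmul Ω q f) := by
  refine Lp.ext ?_
  filter_upwards [coeFn_lmul q (mulC Ω c f), coeFn_mulC hc f, coeFn_mulC hc (lmul Ω q f),
    coeFn_lmul q f] with x h1 h2 h3 h4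
  rw [h1, h2, h3, h4, ← mulLL_apply, map_smul, mulLL_apply]

lemma mulC_linear_comb {f g : E3 → ℝ} (hf : MemLp f ⊤ (volume.restrict Ω))
    (hg : MemLp g ⊤ (volume.restrict Ω)) (c d : ℝ) (w : L2 Ω) :
    mulC Ω (fun x => c * f x + d * g x) w = c • mulC Ω f w + d • mulC Ω g w := by
  have h : MemLp (fun x => c * f x + d * g x) ⊤ (volume.restrict Ω) :=
    (hf.const_mul c).add (hg.const_mul d)
  refine Lp.ext ?_
  filter_upwards [coeFn_mulC h w, coeFn_mulC hf w, coeFn_mulC hg w,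
    Lp.coeFn_add (c • mulC Ω f w) (d • mulC Ω g w), Lp.coeFn_smul c (mulC Ω f w),
    Lp.coeFn_smul d (mulC Ω g w)] with x h1 h2 h3 h4 h5 h6
  rw [h1, h4, Pi.add_apply, h5, h6, Pi.smul_apply, Pi.smul_apply, h2, h3, add_smul, mul_smul,
    mul_smul]

/-- The mixed terms of a first-order pairing are controlled by the derivatives of the
coefficient. -/
lemma abs_inner_mixed_le (hΩ : IsOpen Ω) (hb : Bornology.IsBounded Ω) (hA : IsCoef m Ω A)
    {D : ℝ} (hD0 : 0 ≤ D) (hD : ∀ t, 1 ≤ t → t ≤ m → ∀ l, ∀ x ∈ Ω, |(pd l)^[t] A x| ≤ D)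
    {l j : Fin 3} (hlj : l ≠ j) (U : H0 m Ω) :
    |inner ℝ (lmul Ω (e l) (mulC Ω A (dpd l m U))) (lmul Ω (e j) (dpd j m U))| ≤
      4 ^ m * (D * poincareMax m Ω) * topNorm U ^ 2 := by
  have hc := hA.memLp_self hΩ
  set q := e l * e j with hq
  have hsq : star q = -q := by
    rw [hq, star_mul, star_e, star_e, neg_mul_neg, e_anticomm hlj, neg_neg]
  have hnq : ‖q‖ = 1 := by rw [hq, norm_mul, norm_e, norm_e, one_mul]
  have hX : inner ℝ (lmul Ω (e l) (mulC Ω A (dpd l m U))) (lmul Ω (e j) (dpd j m U)) =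
      inner ℝ (lmul Ω q (dpd l m U)) (mulC Ω A (dpd j m U)) := by
    rw [inner_lmul_lmul, star_e, neg_mul, ← e_anticomm hlj, lmul_mulC _ hc, inner_mulC_left hc]
  -- Since q is skew, the principal parts of the two sides of the swap identity are opposite. Hence
  -- twice the mixed term is a difference of two lower-order errors.
  have hY : inner ℝ (lmul Ω q (dpd j m U)) (mulC Ω A (dpd l m U)) =
      - inner ℝ (lmul Ω q (dpd l m U)) (mulC Ω A (dpd j m U)) := by
    rw [← inner_mulC_left hc, ← lmul_mulC _ hc, real_inner_comm]
    have := inner_lmul_lmul 1 q (dpd l m U) (mulC Ω A (dpd j m U))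
    rw [lmul_one, mul_one, hsq, lmul_neg, inner_neg_left] at this
    exact this
  have hswap := congrArg (·.re) (pairing_leib_swap hΩ hA q l j U U)
  simp only [re_pairing] at hswap
  have hsplit : ∀ i : Fin 3, leib m Ω A i U =
      mulC Ω A (dpd i m U) + (leib m Ω A i U - mulC Ω A (dpd i m U)) := fun i => by abel
  rw [hsplit l, hsplit j, inner_add_right, inner_add_right, hY] at hswap
  have hbd : ∀ i k : Fin 3, |inner ℝ (lmul Ω q (dpd i m U))
      (leib m Ω A k U - mulC Ω A (dpd k m U))| ≤
        4 ^ m * (D * poincareMax m Ω) * topNorm U ^ 2 := by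
    intro i k
    have h1 := poincareMax_nonneg (Ω := Ω) (m := m)
    have h2 := topNorm_nonneg U
    refine (abs_real_inner_le_norm _ _).trans ?_
    have h3 : ‖lmul Ω q (dpd i m U)‖ ≤ topNorm U :=
      (norm_lmul _ _).trans (by rw [hnq, one_mul]; exact norm_dpd_le i U)
    have h4 := norm_leib_sub_le hΩ hb hA hD0 k (fun t ht ht' => hD t ht ht' k) U
    calc _ ≤ topNorm U * (4 ^ m * (D * poincareMax m Ω) * topNorm U) := by gcongr
      _ = _ := by ring
  have b1 := abs_le.1 (hbd l j)
  have b2 := abs_le.1 (hbd j l)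
  rw [hX, abs_le]
  constructor <;> linarith [b1.1, b1.2, b2.1, b2.2]

/-- The two cross terms merge into one mixed term with coefficient σ_j a_l + σ_l a_j, whose pure
derivatives of orders 1 to m are at most 2D. -/
lemma abs_inner_mixed_add_le (hΩ : IsOpen Ω) (hb : Bornology.IsBounded Ω)
    (ha : ∀ l, IsCoef m Ω (a l)) {D : ℝ} (hD0 : 0 ≤ D)
    (hD : ∀ t, 1 ≤ t → t ≤ m → ∀ j l, ∀ x ∈ Ω, |(pd j)^[t] (a l) x| ≤ D)
    {σ : Fin 3 → ℝ} (hσ : ∀ l, |σ l| = 1) {l j : Fin 3} (hlj : l ≠ j) (U : H0 m Ω) :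
    |σ j * inner ℝ (lmul Ω (e l) (mulC Ω (a l) (dpd l m U))) (lmul Ω (e j) (dpd j m U)) +
        σ l * inner ℝ (lmul Ω (e j) (mulC Ω (a j) (dpd j m U))) (lmul Ω (e l) (dpd l m U))| ≤
      4 ^ m * (2 * D * poincareMax m Ω) * topNorm U ^ 2 := by
  have hmem := fun l => (ha l).memLp_self hΩ
  have hA := (ha l).linear_comb hΩ (ha j) (σ j) (σ l)
  have hcomm : inner ℝ (lmul Ω (e j) (mulC Ω (a j) (dpd j m U))) (lmul Ω (e l) (dpd l m U)) =
      inner ℝ (lmul Ω (e l) (mulC Ω (a j) (dpd l m U))) (lmul Ω (e j) (dpd j m U)) := by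
    rw [lmul_mulC _ (hmem j), lmul_mulC _ (hmem j), inner_mulC_left (hmem j), real_inner_comm]
  have hE := congrArg (fun w => (inner ℝ (lmul Ω (e l) w) (lmul Ω (e j) (dpd j m U)) : ℝ))
    (mulC_linear_comb (hmem l) (hmem j) (σ j) (σ l) (dpd l m U))
  simp only [map_add, map_smul, inner_add_left, real_inner_smul_left] at hE
  rw [hcomm, ← hE]
  refine abs_inner_mixed_le hΩ hb hA (by positivity) (fun t h1 h2 i x hx => ?_) hlj U
  rw [iterate_pd_linear_comb hΩ i _ _ t ((ha l).contDiffOn.of_le (by exact_mod_cast h2))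
    ((ha j).contDiffOn.of_le (by exact_mod_cast h2)) hx]
  refine (abs_add_le _ _).trans ?_
  rw [abs_mul, abs_mul, hσ, hσ, one_mul, one_mul]
  linarith [hD t h1 h2 i l x hx, hD t h1 h2 i j x hx]

/-- Ellipticity: pair `T u` with `∑_l σ_l e_l ∂_l^m u`, where `σ_l` is the sign of `a_l`. -/
lemma le_norm_opS (hΩ : IsOpen Ω) (hb : Bornology.IsBounded Ω) (ha : ∀ l, IsCoef m Ω (a l))
    {D : ℝ} (hD0 : 0 ≤ D)
    (hD : ∀ t, 1 ≤ t → t ≤ m → ∀ j l, ∀ x ∈ Ω, |(pd j)^[t] (a l) x| ≤ D)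
    {σ : Fin 3 → ℝ} (hσ : ∀ l, |σ l| = 1) {γ : ℝ} (hγ : ∀ l, ∀ x ∈ Ω, γ ≤ σ l * a l x)
    (U : H0 m Ω) :
    (γ - 6 * (4 ^ m * (D * poincareMax m Ω))) * topNorm U ≤ 3 * ‖opS m Ω a U‖ := by
  have hmem := fun l => (ha l).memLp_self hΩ
  let X : Fin 3 → Fin 3 → ℝ := fun l j =>
    σ j * inner ℝ (lmul Ω (e l) (mulC Ω (a l) (dpd l m U))) (lmul Ω (e j) (dpd j m U))
  have hinner : inner ℝ (opS m Ω a U) (∑ j, σ j • lmul Ω (e j) (dpd j m U)) =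
      ∑ l, ∑ j, X l j := by
    rw [opS_apply, sum_inner]
    refine Finset.sum_congr rfl fun l _ => ?_
    rw [inner_sum]
    exact Finset.sum_congr rfl fun j _ => real_inner_smul_right _ _ _
  have hdiag : ∀ l, γ * ‖dpd l m U‖ ^ 2 ≤ X l l := fun l => by
    have h := le_inner_mulC hΩ ((hmem l).const_mul (σ l)) (hγ l) (dpd l m U)
    have h2 := mulC_linear_comb (hmem l) (hmem l) (σ l) 0 (dpd l m U)
    simp only [zero_mul, add_zero, zero_smul] at h2
    rw [h2, real_inner_smul_left] at h
    simpa only [X, inner_lmul_lmul, star_e, neg_mul, e_mul_self, neg_neg, lmul_one] using h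
  have hoff : ∀ l j, l ≠ j → |X l j + X j l| ≤
      4 ^ m * (2 * D * poincareMax m Ω) * topNorm U ^ 2 := fun l j hlj =>
    abs_inner_mixed_add_le hΩ hb ha hD0 hD hσ hlj U
  have hP : ‖∑ j, σ j • lmul Ω (e j) (dpd j m U)‖ ≤ 3 * topNorm U := by
    refine (norm_sum_le _ _).trans ?_
    have : ∀ j ∈ Finset.univ, ‖σ j • lmul Ω (e j) (dpd j m U)‖ ≤ topNorm U := fun j _ => by
      rw [norm_smul, Real.norm_eq_abs, hσ, one_mul]
      exact (norm_lmul _ _).trans (by rw [norm_e, one_mul]; exact norm_dpd_le j U)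
    refine (Finset.sum_le_card_nsmul _ _ _ this).trans_eq ?_
    simp
  have hcs := (hinner ▸ real_inner_le_norm (opS m Ω a U) _ :
    ∑ l, ∑ j, X l j ≤ ‖opS m Ω a U‖ * ‖∑ j, σ j • lmul Ω (e j) (dpd j m U)‖)
  -- Three pairs l < j, each with coefficient bound 2D, give the 6; the Cauchy–Schwarz inequality
  -- with `hP` gives the 3.
  have hle : (γ - 6 * (4 ^ m * (D * poincareMax m Ω))) * topNorm U ^ 2 ≤
      3 * ‖opS m Ω a U‖ * topNorm U := by
    have h1 : ‖opS m Ω a U‖ * ‖∑ j, σ j • lmul Ω (e j) (dpd j m U)‖ ≤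
      ‖opS m Ω a U‖ * (3 * topNorm U) := by gcongr
    have h2 := sq_topNorm U
    simp only [Fin.sum_univ_three] at hcs h2
    have o1 := (abs_le.1 (hoff 0 1 (by decide))).1
    have o2 := (abs_le.1 (hoff 0 2 (by decide))).1
    have o3 := (abs_le.1 (hoff 1 2 (by decide))).1
    have d0 := hdiag 0
    have d1 := hdiag 1
    have d2 := hdiag 2
    have h3 : γ * topNorm U ^ 2 = γ * ‖dpd 0 m U‖ ^ 2 + γ * ‖dpd 1 m U‖ ^ 2 +
      γ * ‖dpd 2 m U‖ ^ 2 := by rw [h2]; ring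
    simp only [Fin.sum_univ_three] at h1
    linarith
  rcases (topNorm_nonneg U).eq_or_lt with h0 | h0
  · rw [← h0, mul_zero]
    positivity
  · refine le_of_mul_le_mul_right ?_ h0
    linarith

end Estimates

/-! ### Weak solutions -/

section Solutions

variable {m : ℕ} {Ω : Set E3} {a : Fin 3 → E3 → ℝ}

lemma constCT_le (l : Fin 3) {x : E3} (hx : x ∈ Ω) : constCT Ω a ≤ a l x ^ 2 := by
  refine csInf_le ⟨0, ?_⟩ ⟨l, x, hx, rfl⟩
  rintro _ ⟨l, x, -, rfl⟩
  positivity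

lemma derivSup_nonneg : 0 ≤ derivSup m Ω a := by
  refine Real.sSup_nonneg ?_
  rintro _ ⟨t, -, j, l, x, -, rfl⟩
  positivity

lemma le_derivSup (ha : ∀ l, IsCoef m Ω (a l)) {t : ℕ} (h1 : 1 ≤ t) (h2 : t ≤ m) (j l : Fin 3)
    {x : E3} (hx : x ∈ Ω) : |(pd j)^[t] (a l) x| ≤ derivSup m Ω a := by
  choose! C hC using fun l => (ha l).bdd
  refine le_csSup ⟨∑ t ∈ Finset.Icc 1 m, ∑ j, ∑ l, |C l j t|, ?_⟩
    ⟨t, Finset.mem_Icc.2 ⟨h1, h2⟩, j, l, x, hx, rfl⟩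
  rintro _ ⟨t, ht, j, l, x, hx, rfl⟩
  refine ((hC l j t (Finset.mem_Icc.1 ht).2 x hx).trans (le_abs_self _)).trans ?_
  refine le_trans ?_ (Finset.single_le_sum (f := fun t => ∑ j, ∑ l, |C l j t|)
    (fun _ _ => by positivity) ht)
  refine le_trans ?_ (Finset.single_le_sum (f := fun j => ∑ l, |C l j t|)
    (fun _ _ => by positivity) (Finset.mem_univ j))
  exact Finset.single_le_sum (f := fun l => |C l j t|) (fun _ _ => abs_nonneg _)
    (Finset.mem_univ l)

/-- A continuous function that does not vanish on a connected set has constant sign. -/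
lemma exists_sign (hc : IsPreconnected Ω) (ha : ∀ l, IsCoef m Ω (a l))
    (hpos : 0 < constCT Ω a) :
    ∃ σ : Fin 3 → ℝ, (∀ l, |σ l| = 1) ∧ ∀ l, ∀ x ∈ Ω, √(constCT Ω a) ≤ σ l * a l x := by
  have habs : ∀ l, ∀ x ∈ Ω, √(constCT Ω a) ≤ |a l x| := fun l x hx => by
    rw [← Real.sqrt_sq_eq_abs]
    exact Real.sqrt_le_sqrt (constCT_le l hx)
  have : ∀ l, ∃ σ : ℝ, |σ| = 1 ∧ ∀ x ∈ Ω, √(constCT Ω a) ≤ σ * a l x := by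
    intro l
    have hcont := (ha l).contDiffOn.continuousOn
    rcases hc.eq_or_eq_neg_of_sq_eq hcont hcont.abs (fun x _ => by simp)
      (fun {x} hx h => by
        have := habs l x hx
        have h0 := Real.sqrt_pos.2 hpos
        rw [h] at this
        linarith) with h | h
    · exact ⟨1, by simp, fun x hx => by rw [one_mul, h hx]; exact habs l x hx⟩
    · refine ⟨-1, by simp, fun x hx => ?_⟩
      have := h hx
      simp only [Pi.neg_apply] at this
      rw [this]
      simpa using habs l x hx
  choose σ h1 h2 using this
  exact ⟨σ, h1, h2⟩

/-- With `κ = 100 · 4^m`, the operator `T` is elliptic and `T* - T` is small relative to `T`. -/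
lemma elliptic_estimates (hΩ : IsBoundedC1Domain Ω) (ha : ∀ l, IsCoef m Ω (a l))
    (hpos : 0 < constCT Ω a) (hM : 0 < constCT Ω a / 2 - constM (100 * 4 ^ m) m Ω a)
    (U : H0 m Ω) :
    3 / 10 * √(constCT Ω a) * topNorm U ≤ ‖opS m Ω a U‖ ∧
      ‖adjS m Ω a U - opS m Ω a U‖ ≤ 1 / 2 * ‖opS m Ω a U‖ := by
  set γ := √(constCT Ω a) with hγ
  set d := 4 ^ m * (derivSup m Ω a * poincareMax m Ω) with hd
  have hγ0 : 0 < γ := Real.sqrt_pos.2 hpos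
  have hD0 := derivSup_nonneg (m := m) (Ω := Ω) (a := a)
  have hP0 := poincareMax_nonneg (m := m) (Ω := Ω)
  have hS0 := topNorm_nonneg U
  have hd0 : 0 ≤ d := by positivity
  -- With this κ, M = (100 d)², and M < C_T / 2 ≤ γ².
  have hdγ : 100 * d ≤ γ := by
    refine (abs_le_of_sq_le_sq' ?_ hγ0.le).2
    rw [hγ, Real.sq_sqrt hpos.le]
    have : constM (100 * 4 ^ m) m Ω a = (100 * d) ^ 2 := by
      rw [constM, constK, ← poincareMax, hd]
      ring
    linarith
  obtain ⟨σ, hσ, hσa⟩ := exists_sign hΩ.isConnected.isPreconnected ha hpos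
  have hD : ∀ t, 1 ≤ t → t ≤ m → ∀ j l, ∀ x ∈ Ω, |(pd j)^[t] (a l) x| ≤ derivSup m Ω a :=
    fun t h1 h2 j l x hx => le_derivSup ha h1 h2 j l hx
  have h1 := le_norm_opS hΩ.isOpen hΩ.isBounded ha hD0 hD hσ hσa U
  have h2 := norm_adjS_sub_opS_le hΩ.isOpen hΩ.isBounded ha hD0 hD U
  rw [← hd] at h1 h2
  have h3 : d * topNorm U ≤ γ / 100 * topNorm U := by gcongr; linarith
  have h4 : 0 ≤ γ * topNorm U := by positivity
  -- Here 6d ≤ 0.06 γ, so ‖S u‖ ≥ (0.94/3) γ |u|_m, whereas ‖S' u - S u‖ ≤ 0.03 γ |u|_m.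
  constructor <;> linarith

/-- The real part of `b_s` as a continuous bilinear form on `H^m_0`. -/
def reForm (m : ℕ) (Ω : Set E3) (a : Fin 3 → E3 → ℝ) (s : ℍ[ℝ]) :
    H0 m Ω →L[ℝ] H0 m Ω →L[ℝ] ℝ :=
  ‖s‖ ^ 2 • (realInner (H := L2 Ω)).bilinearComp (der 0) (der 0) +
    (realInner (H := L2 Ω)).bilinearComp (opS m Ω a) (adjS m Ω a)

lemma reForm_apply (s : ℍ[ℝ]) (U V : H0 m Ω) :
    reForm m Ω a s U V = ‖s‖ ^ 2 * inner ℝ (der 0 U) (der 0 V) +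
      inner ℝ (opS m Ω a U) (adjS m Ω a V) := rfl

lemma re_bForm (hΩ : IsOpen Ω) (hm : 1 ≤ m) (ha : ∀ l, IsCoef m Ω (a l)) {s : ℍ[ℝ]}
    (hs : s.re = 0) (U V : H0 m Ω) :
    (bForm m Ω a s (der 0 U) (der 0 V)).re = reForm m Ω a s U V := by
  rw [bForm_eq hΩ hm ha hs, reForm_apply, Quaternion.re_add, Quaternion.re_smul, re_pairing,
    re_pairing, smul_eq_mul]

/-- Writing S' = S + (S' - S), the error costs at most half of ‖S u‖². -/
lemma le_reForm (hΩ : IsBoundedC1Domain Ω) (ha : ∀ l, IsCoef m Ω (a l))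
    (hpos : 0 < constCT Ω a) (hM : 0 < constCT Ω a / 2 - constM (100 * 4 ^ m) m Ω a)
    (s : ℍ[ℝ]) (U : H0 m Ω) :
    ‖s‖ ^ 2 * ‖der 0 U‖ ^ 2 + 1 / 2 * ‖opS m Ω a U‖ ^ 2 ≤ reForm m Ω a s U U := by
  have h := (elliptic_estimates hΩ ha hpos hM U).2
  have h1 : adjS m Ω a U = opS m Ω a U + (adjS m Ω a U - opS m Ω a U) := by abel
  have h2 := (abs_le.1 (abs_real_inner_le_norm (opS m Ω a U) (adjS m Ω a U - opS m Ω a U))).1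
  have h3 : ‖opS m Ω a U‖ * ‖adjS m Ω a U - opS m Ω a U‖ ≤
      ‖opS m Ω a U‖ * (1 / 2 * ‖opS m Ω a U‖) := by gcongr
  rw [reForm_apply, h1, inner_add_right, real_inner_self_eq_norm_sq, real_inner_self_eq_norm_sq]
  linarith

lemma isCoercive_reForm (hΩ : IsBoundedC1Domain Ω) (ha : ∀ l, IsCoef m Ω (a l))
    (hpos : 0 < constCT Ω a) (hM : 0 < constCT Ω a / 2 - constM (100 * 4 ^ m) m Ω a)
    (s : ℍ[ℝ]) : IsCoercive (reForm m Ω a s) := by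
  set Q := ∑ β : idx m, (3 * poincareConst Ω ^ 2) ^ (m - ∑ i, β.1 i)
  have hQ0 : 0 ≤ Q := Finset.sum_nonneg fun _ _ => by positivity
  have hQ : ∀ U : H0 m Ω, ‖U‖ ^ 2 ≤ Q * topNorm U ^ 2 := fun U => by
    have : ‖U‖ ^ 2 = ∑ β : idx m, ‖(U : Jet m Ω) β‖ ^ 2 := PiLp.norm_sq_eq_of_L2 _ _
    rw [this, Finset.sum_mul]
    refine Finset.sum_le_sum fun β _ => ?_
    have hβ := mem_idx.1 β.2
    have := norm_sq_der_le hΩ.isBounded (β := β.1) (k := m - ∑ i, β.1 i) (by omega) U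
    rwa [der_apply β.2] at this
  -- 9/200 is ½ (3/10)², from `le_reForm` and the ellipticity constant; Q compares the full norm
  -- with the top-order one, and Q + 1 is evidently positive.
  refine ⟨9 / 200 * constCT Ω a / (Q + 1), by positivity, fun U => ?_⟩
  have h1 := (elliptic_estimates hΩ ha hpos hM U).1
  have h2 := le_reForm hΩ ha hpos hM s U
  have hS := topNorm_nonneg U
  have h3 : 9 / 100 * constCT Ω a * topNorm U ^ 2 ≤ ‖opS m Ω a U‖ ^ 2 := by
    have := pow_le_pow_left₀ (by positivity) h1 2
    rw [mul_pow, mul_pow, Real.sq_sqrt hpos.le] at this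
    linarith
  have h4 : 0 ≤ ‖s‖ ^ 2 * ‖der 0 U‖ ^ 2 := mul_nonneg (sq_nonneg _) (sq_nonneg _)
  have h5 : ‖U‖ ^ 2 ≤ (Q + 1) * topNorm U ^ 2 := by nlinarith [hQ U, sq_nonneg (topNorm U)]
  rw [mul_assoc, ← pow_two, div_mul_eq_mul_div, div_le_iff₀ (by positivity)]
  calc 9 / 200 * constCT Ω a * ‖U‖ ^ 2
      ≤ 9 / 200 * constCT Ω a * ((Q + 1) * topNorm U ^ 2) := by gcongr
    _ = (1 / 2 * (9 / 100 * constCT Ω a * topNorm U ^ 2)) * (Q + 1) := by ring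
    _ ≤ reForm m Ω a s U U * (Q + 1) := by gcongr; linarith

/-- Right multiplication commutes with the real coefficients, and W has the derivatives of v q. -/
lemma leib_rmul {A : E3 → ℝ} (l : Fin 3) {q : ℍ[ℝ]} {V W : H0 m Ω}
    (hW : ∀ β ∈ idx m, der β W = rmul Ω q (der β V)) :
    leib m Ω A l W = rmul Ω q (leib m Ω A l V) := by
  rw [leib_apply, leib_apply, map_sum]
  refine Finset.sum_congr rfl fun t ht => ?_
  have ht' := Finset.HasAntidiagonal.mem_antidiagonal.mp ht
  have h : dpd l t.2 W = rmul Ω q (dpd l t.2 V) := hW _ (single_mem_idx (by omega) l)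
  rw [map_smul, rmul_mulC, h]

lemma adjS_rmul {q : ℍ[ℝ]} {V W : H0 m Ω}
    (hW : ∀ β ∈ idx m, der β W = rmul Ω q (der β V)) :
    adjS m Ω a W = rmul Ω q (adjS m Ω a V) := by
  rw [adjS_apply, adjS_apply, map_sum]
  refine Finset.sum_congr rfl fun l _ => ?_
  rw [leib_rmul l hW, rmul_lmul]

/-- A solution of the real variational problem solves the quaternionic one. -/
lemma bForm_eq_of_reForm_eq (hΩ : IsOpen Ω) (hm : 1 ≤ m) (ha : ∀ l, IsCoef m Ω (a l))
    {s : ℍ[ℝ]} (hs : s.re = 0) {F : L2 Ω} {U : H0 m Ω}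
    (h : ∀ V, reForm m Ω a s U V = inner ℝ F (der 0 V)) (V : H0 m Ω) :
    bForm m Ω a s (der 0 U) (der 0 V) = pairing Ω F (der 0 V) := by
  refine ext_re_mul fun r => ?_
  obtain ⟨W, hW⟩ := exists_rmul r V
  have h0 : der 0 W = rmul Ω r (der 0 V) := hW 0 (mem_idx.2 (by simp))
  -- The form is right linear over ℍ in its second argument.
  have h1 : bForm m Ω a s (der 0 U) (der 0 V) * r = bForm m Ω a s (der 0 U) (der 0 W) := by
    rw [bForm_eq hΩ hm ha hs, bForm_eq hΩ hm ha hs, h0, adjS_rmul hW, pairing_rmul, pairing_rmul,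
      add_mul, smul_mul_assoc]
  rw [h1, re_bForm hΩ hm ha hs, h, h0, ← pairing_rmul, re_pairing]

/-- Lax–Milgram; the adjoint of `der 0`, applied to F, represents the functional v ↦ Re ⟨F, v⟩. -/
lemma exists_reForm_eq {s : ℍ[ℝ]} (h : IsCoercive (reForm m Ω a s)) (F : L2 Ω) :
    ∃ U : H0 m Ω, ∀ V, reForm m Ω a s U V = inner ℝ F (der 0 V) := by
  refine ⟨h.continuousLinearEquivOfBilin.symm (ContinuousLinearMap.adjoint (der 0) F),
    fun V => ?_⟩
  rw [← h.continuousLinearEquivOfBilin_apply, ContinuousLinearEquiv.apply_symm_apply,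
    ContinuousLinearMap.adjoint_inner_left]

/-- The lower bound at W - U annihilates the L² component, because s ≠ 0. Uniqueness is thus
obtained directly for the function rather than for its jet. -/
lemma der_zero_eq_of_reForm_eq {s : ℍ[ℝ]}
    (hle : ∀ U, ‖s‖ ^ 2 * ‖der 0 U‖ ^ 2 + 1 / 2 * ‖opS m Ω a U‖ ^ 2 ≤ reForm m Ω a s U U)
    (hs : s ≠ 0) {U W : H0 m Ω} (h : ∀ V, reForm m Ω a s W V = reForm m Ω a s U V) :
    der 0 W = der 0 U := by
  have hsn : 0 < ‖s‖ ^ 2 := by positivity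
  have hsub : reForm m Ω a s (W - U) = reForm m Ω a s W - reForm m Ω a s U := map_sub _ _ _
  have h1 := hle (W - U)
  rw [hsub, sub_apply, h, sub_self] at h1
  have h2 := sq_nonneg ‖opS m Ω a (W - U)‖
  have h3 : ‖der 0 (W - U)‖ ^ 2 ≤ 0 := nonpos_of_mul_nonpos_right (by linarith) hsn
  have h4 := pow_eq_zero_iff two_ne_zero |>.1 (le_antisymm h3 (sq_nonneg _))
  rw [norm_eq_zero, map_sub] at h4
  exact sub_eq_zero.1 h4

/-- The factor i^(m-1) is a pointwise isometry. -/
lemma integral_norm_opT_sq (hΩ : IsOpen Ω) (ha : ∀ l, IsCoef m Ω (a l)) (U : H0 m Ω) :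
    ∫ x in Ω, ‖opT m Ω a (der 0 U) x‖ ^ 2 = ‖opS m Ω a U‖ ^ 2 := by
  rw [norm_sq_eq_integral]
  refine integral_congr_ae ?_
  have h : ∀ᵐ x ∂volume.restrict Ω, ∀ j : Fin 3,
      lmul Ω (e j) (mulC Ω (a j) (dpd j m U)) x = a j x • mulL (e j) (dpd j m U x) := by
    rw [Filter.eventually_all]
    intro j
    filter_upwards [coeFn_lmul (e j) (mulC Ω (a j) (dpd j m U)),
      coeFn_mulC ((ha j).memLp_self hΩ) (dpd j m U)] with x h1 h2
    rw [h1, h2, ← mulLL_apply, map_smul, mulLL_apply]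
  filter_upwards [h, Lp.coeFn_finsetSum Finset.univ
    fun j => lmul Ω (e j) (mulC Ω (a j) (dpd j m U))] with x h1 h2
  rw [opS_apply, h2, Finset.sum_apply, opT, norm_iterate_mulI]
  simp only [h1, wpd_der hΩ _ le_rfl]

end Solutions

end QuatOp

end

/-! ### Proof of the theorem -/

open QuatOp in
theorem theorem3p2 (m : ℕ) (hm : 1 ≤ m) :
    ∃ κ : ℝ, 0 < κ ∧
      ∀ (Ω : Set QuatOp.E3) (a : Fin 3 → QuatOp.E3 → ℝ),
        QuatOp.IsBoundedC1Domain Ω →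
        (∀ l, QuatOp.IsCmClosure m Ω (a l)) →
        0 < QuatOp.constCT Ω a →
        0 < QuatOp.constCT Ω a / 2 - QuatOp.constM κ m Ω a →
        ∀ s : Quaternion ℝ, s ≠ 0 → s.re = 0 →
          (∀ F : QuatOp.L2 Ω, ∃! u : QuatOp.L2 Ω, QuatOp.IsWeakSolution m Ω a s F u) ∧
          (∀ u : QuatOp.L2 Ω, QuatOp.MemH0 m Ω u →
            ‖u‖ ^ 2 ≤ 1 / ‖s‖ ^ 2 * (QuatOp.bForm m Ω a s u u).re) ∧
          (∀ u : QuatOp.L2 Ω, QuatOp.MemH0 m Ω u →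
            (QuatOp.constCT Ω a - 2 * QuatOp.constM κ m Ω a) / (2 * QuatOp.constCT Ω a) *
                ∫ x in Ω, ‖QuatOp.opT m Ω a u x‖ ^ 2
              ≤ (QuatOp.bForm m Ω a s u u).re) := by
  refine ⟨100 * 4 ^ m, by positivity, fun Ω a hΩ hC hpos hM s hs0 hs => ?_⟩
  have hop := hΩ.isOpen
  have ha : ∀ l, IsCoef m Ω (a l) := fun l => (hC l).isCoef hΩ.isBounded
  have hsn : 0 < ‖s‖ ^ 2 := by positivity
  have hle := le_reForm hΩ ha hpos hM s
  refine ⟨fun F => ?_, fun u hu => ?_, fun u hu => ?_⟩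
  · obtain ⟨U, hU⟩ := exists_reForm_eq (isCoercive_reForm hΩ ha hpos hM s) F
    refine ⟨der 0 U, ⟨memH0_der hop U, fun v hv => ?_⟩, fun w hw => ?_⟩
    · obtain ⟨V, rfl⟩ := exists_der_eq hop hv
      rw [bForm_eq_of_reForm_eq hop hm ha hs hU, pairing_apply, l2Inner]
    · obtain ⟨W, rfl⟩ := exists_der_eq hop hw.1
      have hW : ∀ V, reForm m Ω a s W V = inner ℝ F (der 0 V) := fun V => by
        rw [← re_bForm hop hm ha hs, hw.2 _ (memH0_der hop V), l2Inner, ← pairing_apply,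
          re_pairing]
      exact der_zero_eq_of_reForm_eq hle hs0 fun V => (hW V).trans (hU V).symm
  · obtain ⟨U, rfl⟩ := exists_der_eq hop hu
    rw [re_bForm hop hm ha hs, one_div, ← div_eq_inv_mul, le_div_iff₀ hsn]
    have := sq_nonneg ‖opS m Ω a U‖
    linarith [hle U]
  · obtain ⟨U, rfl⟩ := exists_der_eq hop hu
    rw [re_bForm hop hm ha hs, integral_norm_opT_sq hop ha]
    have hM0 : 0 ≤ constM (100 * 4 ^ m) m Ω a := by unfold constM; positivity
    -- C_1 = ½ - M / C_T is at most ½, so the bound of `le_reForm` is stronger than the one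
    -- required.
    have h1 : (constCT Ω a - 2 * constM (100 * 4 ^ m) m Ω a) / (2 * constCT Ω a) ≤ 1 / 2 := by
      rw [div_le_div_iff₀ (by positivity) two_pos]
      linarith
    have h2 : 0 ≤ ‖s‖ ^ 2 * ‖der 0 U‖ ^ 2 := mul_nonneg (sq_nonneg _) (sq_nonneg _)
    have h3 := mul_le_mul_of_nonneg_right h1 (sq_nonneg ‖opS m Ω a U‖)
    linarith [hle U]
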